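/- Fix integers $\delta \ge 0$ and $n \ge \max(2,\delta+1)$ and real numbers $t_1<\dots<t_n$ (for example $t_i=i$). For $1 \le k \le n$ let $Z(n,k) \subset \mathbb{R}^k$ be the cyclic zonotope, the Minkowski sum of the segments from $\mathbf 0$ to $(1,t_i,\dots,t_i^{k-1})$, $1\le i\le n$. For $0 \le k\le n-1$ let $C(n,k)\subset\mathbb{R}^k$ be the cyclic polytope, the convex hull of the points $(t_i,t_i^2,\dots,t_i^k)$, $1\le i\le n$. A subcomplex of a polytope is a union of faces of it. A *cubillage* of $Z(n,\delta+1)$ is a subcomplex $\mathcal Q$ of $Z(n,n)$ such that the projection of $\mathbb{R}^n$ onto its first $\delta+1$ coordinates restricts to a bijection $\mathcal Q \to Z(n,\delta+1)$. A *triangulation* of $C(n,\delta)$ is a subcomplex $\mathcal T$ of the simplex $C(n,n-1)$ such that the projection of $\mathbb{R}^{n-1}$ onto its first $\delta$ coordinates restricts to a bijection $\mathcal T\to C(n,\delta)$. For $A\subseteq [n]=\{1,\dots,n\}$ put $\xi_A=\sum_{i\in A}(1,t_i,\dots,t_i^{n-1})\in\mathbb{R}^n$, and let $|A|\subset\mathbb{R}^{n-1}$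 be the convex hull of the points $(t_i,\dots,t_i^{n-1})$, $i\in A$. For a cubillage $\mathcal Q$ of $Z(n,\delta+1)$, the *internal spectrum* $\mathrm{ISp}(\mathcal Q)$ is the set of all $A\subseteq[n]$ such that $\xi_A$ is a vertex of $\mathcal Q$ and the projection of $\xi_A$ to $\mathbb{R}^{\delta+1}$ lies in the interior of $Z(n,\delta+1)$. For a triangulation $\mathcal T$ of $C(n,\delta)$, let $\mathring e(\mathcal T)$ be the set of all $A\subseteq[n]$ with $\#A=\lfloor\delta/2\rfloor+1$ such that $|A|$ is a simplex of $\mathcal T$ and the projection of $|A|$ to $\mathbb{R}^\delta$ does not lie within a facet of $C(n,\delta)$ (these $|A|$ are the internal $\lfloor\delta/2\rfloor$-simplices of $\mathcal T$; for $\delta=0$ the point $C(n,0)$ has no non-empty facet, so this last condition is void). Finally let $g(\mathcal Q)=\mathcal Q\cap\{x_1=1\}$, where the hyperplane $\{x_1=1\}$ of $\mathbb{R}^n$ is identified with $\mathbb{R}^{n-1}$ by dropping the first coordinate. **Proposition.** Let $\mathcal Q$ be a cubillage of $Z(n,\delta+1)$. Then $g(\mathcal Q)$ is a triangulation of $C(n,\delta)$,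 and $$\mathring e(g(\mathcal Q))=\mathrm{ISp}(\mathcal Q)\cap\binom{[n]}{\lfloor\delta/2\rfloor+1},$$ where $\binom{[n]}{k}$ denotes the set of $k$-element subsets of $[n]$. Hence $g(\mathcal Q)$ can be described in terms of the collection of subsets of $[n]$ given by the vertices of $\mathcal Q$: it is the only triangulation $\mathcal T$ of $C(n,\delta)$ with $\mathring e(\mathcal T)=\mathrm{ISp}(\mathcal Q)\cap\binom{[n]}{\lfloor\delta/2\rfloor+1}$. -/

import Mathlib

open scoped Pointwise

namespace CyclicCubillage

/-! Polytopes, faces and subcomplexes.  For polytopes, "face" and "exposed face" are the same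
notion; the polytope itself counts as a face. -/

/-- A subcomplex of a polytope `P`: a union of faces of `P`. -/
def IsSubcomplex {m : ℕ} (P S : Set (Fin m → ℝ)) : Prop :=
  ∃ 𝓕 : Set (Set (Fin m → ℝ)), (∀ F ∈ 𝓕, IsExposed ℝ P F) ∧ S = ⋃₀ 𝓕

/-- `F` is a (non-empty) face of the subcomplex `S` of the polytope `P`: a face of `P` that is
contained in `S`. -/
def IsFaceIn {m : ℕ} (P S F : Set (Fin m → ℝ)) : Prop :=
  F.Nonempty ∧ IsExposed ℝ P F ∧ F ⊆ S

/-- `F` is a facet of the polytope `P`: a non-empty face of codimension one. -/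
def IsFacet {m : ℕ} (P F : Set (Fin m → ℝ)) : Prop :=
  F.Nonempty ∧ IsExposed ℝ P F ∧
    Module.finrank ℝ (vectorSpan ℝ F) + 1 = Module.finrank ℝ (vectorSpan ℝ P)

/-- The projection `ℝᵏ → ℝˡ` onto the first `l` coordinates. -/
def proj {k l : ℕ} (h : l ≤ k) : (Fin k → ℝ) →ₗ[ℝ] (Fin l → ℝ) :=
  LinearMap.funLeft ℝ ℝ (Fin.castLE h)

/-! Cyclic zonotopes and cubillages.  The set `{1, …, n}` is represented by `Fin n`, and
`t : Fin n → ℝ` holds the parameters `t₁ < ⋯ < tₙ`. -/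

/-- The point `(1, s, …, s ^ (k - 1))` of the Veronese curve in `ℝᵏ`. -/
def veronese (k : ℕ) (s : ℝ) : Fin k → ℝ := fun i => s ^ (i : ℕ)

/-- The cyclic zonotope `Z(n, k)`: the Minkowski sum of the segments from the origin to the
points of parameters `t₁, …, tₙ` on the Veronese curve in `ℝᵏ`. -/
def zonotope {n : ℕ} (t : Fin n → ℝ) (k : ℕ) : Set (Fin k → ℝ) :=
  ∑ i, segment ℝ 0 (veronese k (t i))

/-- A cubillage of `Z(n, k)`, as a subset of `ℝⁿ`: a subcomplex of `Z(n, n)` which the projection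
maps bijectively onto `Z(n, k)`. -/
def IsCubillage {n k : ℕ} (h : k ≤ n) (t : Fin n → ℝ) (Q : Set (Fin n → ℝ)) : Prop :=
  IsSubcomplex (zonotope t n) Q ∧ Set.BijOn (proj h) Q (zonotope t k)

/-- The point `ξ_A ∈ ℝⁿ`, the sum of the generators of `Z(n, n)` indexed by `A`. -/
def xi {n : ℕ} (t : Fin n → ℝ) (A : Finset (Fin n)) : Fin n → ℝ :=
  ∑ i ∈ A, veronese n (t i)

/-- The spectrum of `Q`: the sets `A` such that `ξ_A` is a vertex of `Q`. -/
def spectrum {n : ℕ} (t : Fin n → ℝ) (Q : Set (Fin n → ℝ)) : Set (Finset (Fin n)) :=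
  {A | IsFaceIn (zonotope t n) Q {xi t A}}

/-- The internal spectrum of a cubillage `Q` of `Z(n, k)`: the sets in the spectrum whose vertex
projects into the interior of `Z(n, k)`. -/
def internalSpectrum {n k : ℕ} (h : k ≤ n) (t : Fin n → ℝ) (Q : Set (Fin n → ℝ)) :
    Set (Finset (Fin n)) :=
  {A | A ∈ spectrum t Q ∧ proj h (xi t A) ∈ interior (zonotope t k)}

/-! Cyclic polytopes and triangulations. -/

/-- The point `(s, s ^ 2, …, s ^ k)` of the moment curve in `ℝᵏ`. -/
def moment (k : ℕ) (s : ℝ) : Fin k → ℝ := fun i => s ^ ((i : ℕ) + 1)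

/-- The cyclic polytope `C(n, k)`: the convex hull of the points of parameters `t₁, …, tₙ` on the
moment curve in `ℝᵏ`. -/
def cyclicPolytope {n : ℕ} (t : Fin n → ℝ) (k : ℕ) : Set (Fin k → ℝ) :=
  convexHull ℝ (Set.range fun i => moment k (t i))

/-- A triangulation of `C(n, k)`, as a subset of `ℝⁿ⁻¹`: a subcomplex of the simplex
`C(n, n - 1)` which the projection maps bijectively onto `C(n, k)`. -/
def IsTriangulation {n k : ℕ} (h : k ≤ n - 1) (t : Fin n → ℝ) (T : Set (Fin (n - 1) → ℝ)) :
    Prop :=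
  IsSubcomplex (cyclicPolytope t (n - 1)) T ∧ Set.BijOn (proj h) T (cyclicPolytope t k)

/-- The simplex `|A| ⊆ ℝⁿ⁻¹` with vertex set indexed by `A`. -/
def simplex {n : ℕ} (t : Fin n → ℝ) (A : Finset (Fin n)) : Set (Fin (n - 1) → ℝ) :=
  convexHull ℝ ((fun i => moment (n - 1) (t i)) '' (A : Set (Fin n)))

/-- The simplex `|A|` is internal in `C(n, k)`: its projection lies within no facet of
`C(n, k)`. -/
def IsInternalSimplex {n k : ℕ} (h : k ≤ n - 1) (t : Fin n → ℝ) (A : Finset (Fin n)) : Prop :=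
  ¬ ∃ F, IsFacet (cyclicPolytope t k) F ∧ proj h '' simplex t A ⊆ F

/-- The sets `A` of size `⌊k / 2⌋ + 1` such that `|A|` is an internal `⌊k / 2⌋`-simplex of the
triangulation `T` of `C(n, k)`. -/
def internalSimplices {n k : ℕ} (h : k ≤ n - 1) (t : Fin n → ℝ) (T : Set (Fin (n - 1) → ℝ)) :
    Set (Finset (Fin n)) :=
  {A | A.card = k / 2 + 1 ∧ IsFaceIn (cyclicPolytope t (n - 1)) T (simplex t A) ∧
    IsInternalSimplex h t A}

/-! The map from cubillages to triangulations. -/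

/-- The map `(x₁, …, xₙ₋₁) ↦ (1, x₁, …, xₙ₋₁)`, which identifies `ℝⁿ⁻¹` with the hyperplane of
`ℝⁿ` where the first coordinate is `1` (for `n ≥ 1`). -/
def intoHyperplane {n : ℕ} (x : Fin (n - 1) → ℝ) : Fin n → ℝ :=
  fun i => if h : (i : ℕ) = 0 then 1 else x ⟨(i : ℕ) - 1, by omega⟩

/-- The map `g`: the intersection of `Q` with the hyperplane of `ℝⁿ` where the first coordinate
is `1`, regarded as a subset of `ℝⁿ⁻¹`. -/
def g {n : ℕ} (Q : Set (Fin n → ℝ)) : Set (Fin (n - 1) → ℝ) :=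
  intoHyperplane ⁻¹' Q

end CyclicCubillage

namespace CyclicCubillage

open Finset Polynomial

/-! Everything is pulled back to coefficient vectors. `Z(n, n)` is the linearly isomorphic image of
the unit cube, and its slice at height one is the image of the standard simplex, i.e. `C(n, n - 1)`.
A subcomplex contains the smallest face around each of its points, so slicing a cubillage gives a
triangulation (`IsCubillage.isTriangulation_g`). Functionals on Veronese vectors are polynomials,
and testing a dependence in `ℝᵟ⁺¹` against a squared product shows that it has at least `⌊δ / 2⌋ +
1` positive coefficients (`half_lt_card_pos`).

Let `#A = ⌊δ / 2⌋ + 1`. If `ξ_A` lies in `Q`, lift the projection of `s ξ_A` to `Q` for `s < 1` near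
`1`. The lift is close to `ξ_A`, and the sign bound keeps its coefficients on `A` at most `s`, so
the smallest cube face around it contains `|A|` (`IsCubillage.simplex_subset_g`). Conversely, the
smallest face around the barycentre of `|A|` contains `ξ_A`. Lying in a facet of `C(n, δ)` and
projecting to the boundary of `Z(n, δ + 1)` both amount to `HasSupportingPolynomial`, which matches
the two notions of internal.

For uniqueness, boundary simplices lie in every triangulation, so the internal ones determine all
`⌊δ / 2⌋`-simplices. Two different lifts of one point differ by a dependence, which reduces to a
conformal one on at most `δ + 2` indices. Its positive part `P` and negative part `N` give simplices
in the respective triangulations with intersecting projections. One part has exactly `⌊δ / 2⌋ + 1`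
elements, so its simplex lies in both triangulations, contradicting injectivity
(`IsTriangulation.subset_of_simplices`). -/

/-- The linear map sending coefficients `w` to `∑ i, wᵢ (1, tᵢ, …, tᵢ ^ (k - 1))`. -/
noncomputable def zonotopeMap {n : ℕ} (t : Fin n → ℝ) (k : ℕ) :
    (Fin n → ℝ) →ₗ[ℝ] (Fin k → ℝ) :=
  Fintype.linearCombination ℝ fun i => veronese k (t i)

/-- The linear map sending coefficients `w` to `∑ i, wᵢ (tᵢ, …, tᵢ ^ k)`. -/
noncomputable def momentMap {n : ℕ} (t : Fin n → ℝ) (k : ℕ) :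
    (Fin n → ℝ) →ₗ[ℝ] (Fin k → ℝ) :=
  Fintype.linearCombination ℝ fun i => moment k (t i)

/-- The linear functional on `ℝᵏ` whose coordinates are the coefficients of `f`. -/
noncomputable def coeffFunctional (f : ℝ[X]) (k : ℕ) : (Fin k → ℝ) →ₗ[ℝ] ℝ :=
  ∑ m : Fin k, f.coeff m • LinearMap.proj m

/-- The indicator vector of `A`. -/
def indicatorVec {n : ℕ} (A : Finset (Fin n)) : Fin n → ℝ := fun i => if i ∈ A then 1 else 0

/-- The face of the standard simplex spanned by the basis vectors indexed by `A`. -/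
def stdFace {n : ℕ} (A : Finset (Fin n)) : Set (Fin n → ℝ) :=
  {w | w ∈ stdSimplex ℝ (Fin n) ∧ ∀ i ∉ A, w i = 0}

variable {n k δ : ℕ} {t : Fin n → ℝ}

/-! ### Coefficient coordinates -/

lemma zonotopeMap_apply (w : Fin n → ℝ) (m : Fin k) :
    zonotopeMap t k w m = ∑ i, w i * t i ^ (m : ℕ) := by
  simp [zonotopeMap, Fintype.linearCombination_apply, veronese]

lemma momentMap_apply (w : Fin n → ℝ) (m : Fin k) :
    momentMap t k w m = ∑ i, w i * t i ^ ((m : ℕ) + 1) := by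
  simp [momentMap, Fintype.linearCombination_apply, moment]

lemma zonotopeMap_single (j : Fin n) : zonotopeMap t k (Pi.single j 1) = veronese k (t j) := by
  simp [zonotopeMap, Fintype.linearCombination_apply_single]

lemma momentMap_single (j : Fin n) : momentMap t k (Pi.single j 1) = moment k (t j) := by
  simp [momentMap, Fintype.linearCombination_apply_single]

lemma zonotopeMap_indicatorVec (A : Finset (Fin n)) :
    zonotopeMap t n (indicatorVec A) = xi t A := by
  simp [zonotopeMap, Fintype.linearCombination_apply, xi, indicatorVec, Finset.sum_ite_mem]

lemma proj_zonotopeMap (h : k ≤ n) (w : Fin n → ℝ) :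
    proj h (zonotopeMap t n w) = zonotopeMap t k w := by
  ext m
  simp [proj, LinearMap.funLeft_apply, zonotopeMap_apply]

lemma proj_momentMap (h : k ≤ n - 1) (w : Fin n → ℝ) :
    proj h (momentMap t (n - 1) w) = momentMap t k w := by
  ext m
  simp [proj, LinearMap.funLeft_apply, momentMap_apply]

/-- A Veronese vector is a moment vector with a leading `1`, so linear dependences in `ℝᵏ⁺¹` encode
affine dependences in `ℝᵏ`. -/
lemma zonotopeMap_eq_iff {w v : Fin n → ℝ} :
    zonotopeMap t (k + 1) w = zonotopeMap t (k + 1) v ↔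
      ∑ i, w i = ∑ i, v i ∧ momentMap t k w = momentMap t k v := by
  constructor
  · intro h
    refine ⟨by simpa [zonotopeMap_apply] using congrFun h 0, ?_⟩
    ext m
    simpa [zonotopeMap_apply, momentMap_apply] using congrFun h m.succ
  · rintro ⟨h0, h⟩
    ext m
    refine Fin.cases ?_ (fun m => ?_) m
    · simpa [zonotopeMap_apply] using h0
    · simpa [zonotopeMap_apply, momentMap_apply] using congrFun h m

/-! ### Linear dependences tested against polynomials -/

lemma coeffFunctional_veronese {f : ℝ[X]} (hf : f.natDegree < k) (s : ℝ) :
    coeffFunctional f k (veronese k s) = f.eval s := by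
  rw [eval_eq_sum_range' hf, ← Fin.sum_univ_eq_sum_range (fun i => f.coeff i * s ^ i)]
  simp [coeffFunctional, veronese]

lemma map_zonotopeMap (l : (Fin k → ℝ) →ₗ[ℝ] ℝ) (w : Fin n → ℝ) :
    l (zonotopeMap t k w) = ∑ i, w i * l (veronese k (t i)) := by
  simp [zonotopeMap, Fintype.linearCombination_apply]

lemma map_momentMap (l : (Fin k → ℝ) →ₗ[ℝ] ℝ) (w : Fin n → ℝ) :
    l (momentMap t k w) = ∑ i, w i * l (moment k (t i)) := by
  simp [momentMap, Fintype.linearCombination_apply]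

lemma sum_mul_eval_eq_zero {w : Fin n → ℝ} (hw : zonotopeMap t k w = 0) {f : ℝ[X]}
    (hf : f.natDegree < k) : ∑ i, w i * f.eval (t i) = 0 := by
  have := map_zonotopeMap (t := t) (coeffFunctional f k) w
  simpa [hw, coeffFunctional_veronese hf] using this.symm

lemma eval_prod_X_sub_C_eq_zero_iff (ht : Function.Injective t) {S : Finset (Fin n)} {j : Fin n} :
    (∏ i ∈ S, (X - C (t i))).eval (t j) = 0 ↔ j ∈ S := by
  rw [eval_prod, Finset.prod_eq_zero_iff]
  constructor
  · rintro ⟨i, hi, h⟩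
    rw [eval_sub, eval_X, eval_C, sub_eq_zero] at h
    rwa [ht h]
  · intro h
    exact ⟨j, h, by simp⟩

/-- Any `k` points of the Veronese curve in `ℝᵏ` are linearly independent. -/
lemma eq_zero_of_zonotopeMap_eq_zero (ht : Function.Injective t) {w : Fin n → ℝ}
    (hw : zonotopeMap t k w = 0) {S : Finset (Fin n)} (hS : #S ≤ k) (hwS : ∀ i ∉ S, w i = 0) :
    w = 0 := by
  ext j
  by_contra hj
  have hjS : j ∈ S := by
    by_contra h
    exact hj (hwS j h)
  have hpos := Finset.card_pos.2 ⟨j, hjS⟩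
  -- This polynomial vanishes at every node of `S` except `t j`, so it isolates the coefficient `w
  -- j`.
  have hdeg : (∏ i ∈ S.erase j, (X - C (t i))).natDegree < k := by
    rw [natDegree_prod_of_monic _ _ fun i _ => monic_X_sub_C _]
    simp [Finset.card_erase_of_mem hjS]
    omega
  have h := sum_mul_eval_eq_zero hw hdeg
  rw [Finset.sum_eq_single j] at h
  · rcases mul_eq_zero.1 h with h | h
    · exact hj h
    · exact absurd ((eval_prod_X_sub_C_eq_zero_iff ht).1 h) (Finset.notMem_erase j S)
  · intro i _ hij
    by_cases hi : i ∈ S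
    · rw [(eval_prod_X_sub_C_eq_zero_iff ht).2 (Finset.mem_erase.2 ⟨hij, hi⟩), mul_zero]
    · rw [hwS i hi, zero_mul]
  · simp

/-- A non-zero linear dependence of the Veronese vectors in `ℝᵟ⁺¹` has at least `⌊δ / 2⌋ + 1`
positive coefficients. -/
lemma half_lt_card_pos (ht : Function.Injective t) {w : Fin n → ℝ}
    (hw : zonotopeMap t (δ + 1) w = 0) (hw0 : w ≠ 0) {A : Finset (Fin n)}
    (hA : ∀ i ∉ A, w i ≤ 0) : δ / 2 + 1 ≤ #A := by
  by_contra! hcard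
  -- The square is non-negative, vanishes exactly on `A` among the nodes, and has degree `2 * #A ≤
  -- δ`. All terms of the sum are then non-positive, hence zero, so `w` is supported on `A`.
  set f : ℝ[X] := (∏ i ∈ A, (X - C (t i))) ^ 2 with hf
  have hdeg : f.natDegree < δ + 1 := by
    rw [hf, natDegree_pow, natDegree_prod_of_monic _ _ fun i _ => monic_X_sub_C _]
    simp
    omega
  have hle : ∀ i, w i * f.eval (t i) ≤ 0 := fun i => by
    by_cases hi : i ∈ A
    · rw [hf, eval_pow, (eval_prod_X_sub_C_eq_zero_iff ht).2 hi]
      simp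
    · rw [hf, eval_pow]
      exact mul_nonpos_of_nonpos_of_nonneg (hA i hi) (sq_nonneg _)
  have hzero := (Finset.sum_eq_zero_iff_of_nonpos fun i _ => hle i).1 (sum_mul_eval_eq_zero hw hdeg)
  refine hw0 (eq_zero_of_zonotopeMap_eq_zero ht hw (S := A) (by omega) fun i hi => ?_)
  rcases mul_eq_zero.1 (hzero i (Finset.mem_univ i)) with h | h
  · exact h
  · rw [hf, eval_pow] at h
    exact absurd ((eval_prod_X_sub_C_eq_zero_iff ht).1 (pow_eq_zero_iff (two_ne_zero) |>.1 h)) hi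

lemma zonotopeMap_injective (ht : Function.Injective t) : Function.Injective (zonotopeMap t n) :=
  (injective_iff_map_eq_zero _).2 fun _ hw =>
    eq_zero_of_zonotopeMap_eq_zero ht hw (S := Finset.univ) (by simp) (by simp)

lemma zonotopeMap_bijective (ht : Function.Injective t) : Function.Bijective (zonotopeMap t n) :=
  ⟨zonotopeMap_injective ht, LinearMap.injective_iff_surjective.1 (zonotopeMap_injective ht)⟩

lemma proj_surjective (h : k ≤ n) : Function.Surjective (proj h) :=
  LinearMap.funLeft_surjective_of_injective ℝ ℝ _ (Fin.castLE_injective h)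

lemma zonotopeMap_surjective (ht : Function.Injective t) (h : k ≤ n) :
    Function.Surjective (zonotopeMap t k) := by
  intro x
  obtain ⟨y, rfl⟩ := proj_surjective h x
  obtain ⟨w, rfl⟩ := (zonotopeMap_bijective ht).2 y
  exact ⟨w, (proj_zonotopeMap h w).symm⟩

/-! ### Zonotopes and cyclic polytopes as images of the cube and the simplex -/

lemma zonotope_eq_image (t : Fin n → ℝ) (k : ℕ) :
    zonotope t k = zonotopeMap t k '' Set.Icc 0 1 := by
  ext x
  rw [zonotope, Set.mem_fintype_sum]
  constructor
  · rintro ⟨y, hy, rfl⟩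
    simp only [segment_eq_image, Set.mem_image] at hy
    choose w hw hwy using hy
    refine ⟨w, ⟨fun i => (hw i).1, fun i => (hw i).2⟩, ?_⟩
    simp [zonotopeMap, Fintype.linearCombination_apply, ← hwy]
  · rintro ⟨w, hw, rfl⟩
    refine ⟨fun i => w i • veronese k (t i), fun i => ?_, by
      simp [zonotopeMap, Fintype.linearCombination_apply]⟩
    rw [segment_eq_image]
    exact ⟨w i, ⟨hw.1 i, hw.2 i⟩, by simp⟩

lemma stdFace_univ : stdFace (Finset.univ : Finset (Fin n)) = stdSimplex ℝ (Fin n) := by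
  simp [stdFace]

lemma convex_stdFace (A : Finset (Fin n)) : Convex ℝ (stdFace A) := by
  intro x hx y hy a b ha hb hab
  refine ⟨convex_stdSimplex ℝ _ hx.1 hy.1 ha hb hab, fun i hi => ?_⟩
  simp [hx.2 i hi, hy.2 i hi]

lemma single_mem_stdFace {A : Finset (Fin n)} {i : Fin n} (hi : i ∈ A) :
    Pi.single i 1 ∈ stdFace A := by
  refine ⟨single_mem_stdSimplex ℝ i, fun j hj => ?_⟩
  rw [Pi.single_apply, if_neg]
  rintro rfl
  exact hj hi

lemma convexHull_moment_image (A : Finset (Fin n)) :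
    convexHull ℝ ((fun i => moment k (t i)) '' (A : Set (Fin n))) = momentMap t k '' stdFace A := by
  apply Set.Subset.antisymm
  · refine convexHull_min ?_ ((convex_stdFace A).linear_image _)
    rintro _ ⟨i, hi, rfl⟩
    exact ⟨_, single_mem_stdFace hi, momentMap_single i⟩
  · rintro _ ⟨w, ⟨hw, hwA⟩, rfl⟩
    have hsum : momentMap t k w = ∑ i ∈ A, w i • moment k (t i) := by
      rw [momentMap, Fintype.linearCombination_apply]
      exact (Finset.sum_subset (Finset.subset_univ A) fun i _ hi => by simp [hwA i hi]).symm
    rw [hsum]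
    refine (convex_convexHull ℝ _).sum_mem (fun i _ => hw.1 i) ?_ fun i hi =>
      subset_convexHull ℝ _ ⟨i, hi, rfl⟩
    rw [← hw.2]
    exact Finset.sum_subset (Finset.subset_univ A) fun i _ hi => hwA i hi

lemma simplex_eq_image (A : Finset (Fin n)) :
    simplex t A = momentMap t (n - 1) '' stdFace A :=
  convexHull_moment_image A

lemma cyclicPolytope_eq_image (t : Fin n → ℝ) (k : ℕ) :
    cyclicPolytope t k = momentMap t k '' stdSimplex ℝ (Fin n) := by
  rw [← stdFace_univ, ← convexHull_moment_image, cyclicPolytope]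
  simp

lemma intoHyperplane_momentMap {w : Fin n → ℝ} (hw : ∑ i, w i = 1) :
    intoHyperplane (momentMap t (n - 1) w) = zonotopeMap t n w := by
  ext i
  unfold intoHyperplane
  split_ifs with h
  · simp [zonotopeMap_apply, h, hw]
  · rw [momentMap_apply, zonotopeMap_apply]
    simp only [Nat.sub_add_cancel (Nat.one_le_iff_ne_zero.2 h)]

lemma momentMap_injOn (ht : Function.Injective t) :
    Set.InjOn (momentMap t (n - 1)) {w | ∑ i, w i = 1} := by
  intro w hw v hv h
  apply zonotopeMap_injective ht
  rw [← intoHyperplane_momentMap hw, ← intoHyperplane_momentMap hv, h]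

lemma sum_eq_one_of_mem_g (hn : 0 < n) {w : Fin n → ℝ} {x : Fin (n - 1) → ℝ}
    (h : intoHyperplane x = zonotopeMap t n w) : ∑ i, w i = 1 := by
  have := congrFun h ⟨0, hn⟩
  simpa [intoHyperplane, zonotopeMap_apply] using this.symm

lemma intoHyperplane_injective : Function.Injective (intoHyperplane (n := n)) := by
  intro x y h
  ext i
  have := congrFun h ⟨i + 1, by omega⟩
  simpa [intoHyperplane] using this

/-! ### Subcomplexes and smallest faces -/

lemma IsSubcomplex.subset {m : ℕ} {P S : Set (Fin m → ℝ)} (h : IsSubcomplex P S) : S ⊆ P := by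
  obtain ⟨𝓕, h𝓕, rfl⟩ := h
  exact Set.sUnion_subset fun F hF => (h𝓕 F hF).subset

lemma IsSubcomplex.exists_functional {m : ℕ} {P S : Set (Fin m → ℝ)} (h : IsSubcomplex P S)
    {x : Fin m → ℝ} (hx : x ∈ S) :
    ∃ l : (Fin m → ℝ) →ₗ[ℝ] ℝ, (∀ y ∈ P, l y ≤ l x) ∧ ∀ y ∈ P, l y = l x → y ∈ S := by
  obtain ⟨𝓕, h𝓕, rfl⟩ := h
  obtain ⟨F, hF, hxF⟩ := hx
  obtain ⟨l, hl⟩ := h𝓕 F hF ⟨x, hxF⟩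
  have hxF' := hxF
  rw [hl] at hxF'
  refine ⟨l, hxF'.2, fun y hy hyx => ⟨F, hF, ?_⟩⟩
  rw [hl]
  refine ⟨hy, fun z hz => ?_⟩
  have := hxF'.2 z hz
  simp only [ContinuousLinearMap.coe_coe] at hyx
  rwa [hyx]

lemma mem_zonotope {w : Fin n → ℝ} (hw : w ∈ Set.Icc (0 : Fin n → ℝ) 1) :
    zonotopeMap t k w ∈ zonotope t k := by
  rw [zonotope_eq_image]
  exact ⟨w, hw, rfl⟩

lemma mem_cyclicPolytope {w : Fin n → ℝ} (hw : w ∈ stdSimplex ℝ (Fin n)) :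
    momentMap t k w ∈ cyclicPolytope t k := by
  rw [cyclicPolytope_eq_image]
  exact ⟨w, hw, rfl⟩

/-- A subcomplex of `Z(n, n)` contains, with each point, the smallest face around that point. -/
lemma IsSubcomplex.zonotopeMap_mem {Q : Set (Fin n → ℝ)} (hQ : IsSubcomplex (zonotope t n) Q)
    {q y : Fin n → ℝ} (hq : zonotopeMap t n q ∈ Q) (hq1 : q ∈ Set.Icc (0 : Fin n → ℝ) 1)
    (hy : y ∈ Set.Icc (0 : Fin n → ℝ) 1) (h : ∀ i, q i = 0 ∨ q i = 1 → y i = q i) :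
    zonotopeMap t n y ∈ Q := by
  obtain ⟨l, hl, hlQ⟩ := hQ.exists_functional hq
  refine hlQ _ (mem_zonotope hy) ?_
  have hzero : ∀ i, ¬ (q i = 0 ∨ q i = 1) → l (veronese n (t i)) = 0 := fun i hi => by
    push Not at hi
    have h0 : 0 < q i := lt_of_le_of_ne (hq1.1 i) (Ne.symm hi.1)
    have h1 : q i < 1 := lt_of_le_of_ne (hq1.2 i) hi.2
    -- Replacing the coefficient `q i` by `s` stays in the cube, so it cannot increase `l`; `s = 0`
    -- and `s = 1` give opposite signs.
    have key : ∀ s : ℝ, 0 ≤ s → s ≤ 1 → (s - q i) * l (veronese n (t i)) ≤ 0 := fun s hs0 hs1 => by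
      have hmem : q + (s - q i) • Pi.single i (1 : ℝ) ∈ Set.Icc (0 : Fin n → ℝ) 1 := by
        constructor <;> intro j <;> by_cases hj : j = i
        · subst hj; simpa using hs0
        · simpa [hj] using hq1.1 j
        · subst hj; simpa using hs1
        · simpa [hj] using hq1.2 j
      have := hl _ (mem_zonotope hmem)
      rw [map_add, map_smul, zonotopeMap_single, map_add, map_smul, smul_eq_mul] at this
      linarith
    have k0 := key 0 le_rfl zero_le_one
    have k1 := key 1 zero_le_one le_rfl
    apply le_antisymm
    · nlinarith
    · nlinarith
  rw [map_zonotopeMap, map_zonotopeMap]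
  refine Finset.sum_congr rfl fun i _ => ?_
  by_cases hi : q i = 0 ∨ q i = 1
  · rw [h i hi]
  · rw [hzero i hi, mul_zero, mul_zero]

/-- A subcomplex of `C(n, n - 1)` contains, with each point, the smallest face around that
point. -/
lemma IsSubcomplex.momentMap_mem {T : Set (Fin (n - 1) → ℝ)}
    (hT : IsSubcomplex (cyclicPolytope t (n - 1)) T) {q y : Fin n → ℝ}
    (hq : momentMap t (n - 1) q ∈ T) (hq1 : q ∈ stdSimplex ℝ (Fin n))
    (hy : y ∈ stdSimplex ℝ (Fin n)) (h : ∀ i, q i = 0 → y i = 0) :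
    momentMap t (n - 1) y ∈ T := by
  obtain ⟨l, hl, hlT⟩ := hT.exists_functional hq
  refine hlT _ (mem_cyclicPolytope hy) ?_
  set m := l (momentMap t (n - 1) q) with hm
  have hle : ∀ i, l (moment (n - 1) (t i)) ≤ m := fun i => by
    have := hl _ (mem_cyclicPolytope (single_mem_stdSimplex ℝ i))
    rwa [momentMap_single] at this
  have hsum : ∑ i, q i * (m - l (moment (n - 1) (t i))) = 0 := by
    simp only [mul_sub, Finset.sum_sub_distrib, ← Finset.sum_mul, hq1.2, one_mul]
    rw [hm, map_momentMap, sub_self]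
  have hzero := (Finset.sum_eq_zero_iff_of_nonneg fun i _ =>
    mul_nonneg (hq1.1 i) (sub_nonneg.2 (hle i))).1 hsum
  rw [map_momentMap]
  calc ∑ i, y i * l (moment (n - 1) (t i)) = ∑ i, y i * m := by
        refine Finset.sum_congr rfl fun i _ => ?_
        rcases mul_eq_zero.1 (hzero i (Finset.mem_univ i)) with h0 | h0
        · rw [h i h0, zero_mul, zero_mul]
        · rw [sub_eq_zero.1 h0]
    _ = m := by rw [← Finset.sum_mul, hy.2, one_mul]

/-! ### Faces exposed by polynomials -/

/-- The moment curve has no constant coordinate; `divX` shifts the coefficients accordingly, at the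
cost of the constant term. -/
lemma coeffFunctional_divX_moment {f : ℝ[X]} (hf : f.natDegree ≤ k) (s : ℝ) :
    coeffFunctional f.divX k (moment k s) = f.eval s - f.coeff 0 := by
  rw [eval_eq_sum_range' (Nat.lt_succ_of_le hf), Finset.sum_range_succ',
    ← Fin.sum_univ_eq_sum_range (fun i => f.coeff (i + 1) * s ^ (i + 1))]
  simp [coeffFunctional, moment]

/-- A polynomial of degree at most `k` that is non-negative at all `tᵢ` exposes a face of
`C(n, k)`. -/
lemma isExposed_momentMap_image_stdFace {f : ℝ[X]} (hf : f.natDegree ≤ k)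
    (hf0 : ∀ i, 0 ≤ f.eval (t i)) {S : Finset (Fin n)} (hS : ∀ i, i ∈ S ↔ f.eval (t i) = 0) :
    IsExposed ℝ (cyclicPolytope t k) (momentMap t k '' stdFace S) := by
  rintro ⟨_, v, hv, rfl⟩
  set l : (Fin k → ℝ) →ₗ[ℝ] ℝ := -coeffFunctional f.divX k with hl
  have hval : ∀ w ∈ stdSimplex ℝ (Fin n),
      l (momentMap t k w) = f.coeff 0 - ∑ i, w i * f.eval (t i) := fun w hw => by
    rw [hl, LinearMap.neg_apply, map_momentMap]
    simp only [coeffFunctional_divX_moment hf, mul_sub, Finset.sum_sub_distrib, ← Finset.sum_mul,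
      hw.2]
    ring
  have hzero : ∀ w ∈ stdFace S, ∑ i, w i * f.eval (t i) = 0 := fun w hw =>
    Finset.sum_eq_zero fun i _ => by
      by_cases hi : i ∈ S
      · rw [(hS i).1 hi, mul_zero]
      · rw [hw.2 i hi, zero_mul]
  have hnonneg : ∀ w ∈ stdSimplex ℝ (Fin n), ∀ i ∈ Finset.univ, 0 ≤ w i * f.eval (t i) :=
    fun w hw i _ => mul_nonneg (hw.1 i) (hf0 i)
  refine ⟨LinearMap.toContinuousLinearMap l, ?_⟩
  simp only [LinearMap.coe_toContinuousLinearMap']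
  ext x
  rw [cyclicPolytope_eq_image]
  constructor
  · rintro ⟨w, hw, rfl⟩
    refine ⟨⟨w, hw.1, rfl⟩, ?_⟩
    rintro _ ⟨y, hy, rfl⟩
    rw [hval y hy, hval w hw.1, hzero w hw]
    linarith [Finset.sum_nonneg (hnonneg y hy)]
  · rintro ⟨⟨w, hw, rfl⟩, hmax⟩
    refine ⟨w, ⟨hw, fun i hi => ?_⟩, rfl⟩
    have h1 := hmax _ ⟨v, hv.1, rfl⟩
    rw [hval w hw, hval v hv.1, hzero v hv] at h1
    have h2 := (Finset.sum_eq_zero_iff_of_nonneg (hnonneg w hw)).1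
      (le_antisymm (by linarith) (Finset.sum_nonneg (hnonneg w hw))) i (Finset.mem_univ i)
    exact (mul_eq_zero.1 h2).resolve_right fun h => hi ((hS i).2 h)

/-- Lagrange interpolation at the parameters `tᵢ`. -/
lemma exists_polynomial_eval_eq (hn : 0 < n) (ht : Function.Injective t) (r : Fin n → ℝ) :
    ∃ f : ℝ[X], f.natDegree < n ∧ ∀ i, f.eval (t i) = r i := by
  refine ⟨Lagrange.interpolate Finset.univ t r, ?_, fun i =>
    Lagrange.eval_interpolate_at_node r ht.injOn (Finset.mem_univ i)⟩
  have h := Lagrange.degree_interpolate_lt (s := Finset.univ) r ht.injOn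
  rw [Finset.card_univ, Fintype.card_fin] at h
  by_cases h0 : Lagrange.interpolate Finset.univ t r = 0
  · rw [h0]; simpa using hn
  · exact (natDegree_lt_iff_degree_lt h0).2 h

/-- Interpolating `0` on `A` and `1` off `A` exposes `|A|` in the full simplex, so only containment
in `T` is a condition. -/
lemma isFaceIn_simplex_iff (hn : 0 < n) (ht : Function.Injective t) {T : Set (Fin (n - 1) → ℝ)}
    {A : Finset (Fin n)} (hA : A.Nonempty) :
    IsFaceIn (cyclicPolytope t (n - 1)) T (simplex t A) ↔ simplex t A ⊆ T := by
  refine ⟨fun h => h.2.2, fun h => ⟨?_, ?_, h⟩⟩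
  · obtain ⟨i, hi⟩ := hA
    rw [simplex_eq_image]
    exact ⟨_, _, single_mem_stdFace hi, rfl⟩
  · obtain ⟨f, hf, hfr⟩ := exists_polynomial_eval_eq hn ht fun i => if i ∈ A then 0 else 1
    rw [simplex_eq_image]
    refine isExposed_momentMap_image_stdFace (f := f) (by omega) (fun i => ?_) fun i => ?_
    · rw [hfr]; split_ifs <;> simp
    · rw [hfr]; simp

lemma indicatorVec_mem_Icc (A : Finset (Fin n)) : indicatorVec A ∈ Set.Icc (0 : Fin n → ℝ) 1 := by
  constructor <;> intro i <;> simp only [indicatorVec] <;> split_ifs <;> simp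

/-- Interpolating `1` on `A` and `-1` off `A` gives a functional maximised on the zonotope only at
`ξ_A`. -/
lemma mem_spectrum_iff (hn : 0 < n) (ht : Function.Injective t) {Q : Set (Fin n → ℝ)}
    {A : Finset (Fin n)} : A ∈ spectrum t Q ↔ xi t A ∈ Q := by
  refine ⟨fun h => h.2.2 rfl, fun h => ⟨Set.singleton_nonempty _, fun _ => ?_, by simpa using h⟩⟩
  obtain ⟨f, hf, hfr⟩ := exists_polynomial_eval_eq hn ht fun i => if i ∈ A then 1 else -1
  refine ⟨LinearMap.toContinuousLinearMap (coeffFunctional f n), ?_⟩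
  simp only [LinearMap.coe_toContinuousLinearMap']
  have hval : ∀ w : Fin n → ℝ, coeffFunctional f n (zonotopeMap t n w) =
      ∑ i, w i * if i ∈ A then 1 else -1 := fun w => by
    simp [map_zonotopeMap, coeffFunctional_veronese hf, hfr]
  have hle : ∀ w ∈ Set.Icc (0 : Fin n → ℝ) 1, ∀ i ∈ Finset.univ,
      (w i * if i ∈ A then (1 : ℝ) else -1) ≤ indicatorVec A i * if i ∈ A then 1 else -1 := by
    intro w hw i _
    have h0 := hw.1 i
    have h1 := hw.2 i
    simp only [Pi.zero_apply, Pi.one_apply] at h0 h1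
    simp only [indicatorVec]
    split_ifs <;> linarith
  rw [← zonotopeMap_indicatorVec, zonotope_eq_image]
  ext x
  simp only [Set.mem_singleton_iff]
  constructor
  · rintro rfl
    refine ⟨⟨_, indicatorVec_mem_Icc A, rfl⟩, ?_⟩
    rintro _ ⟨w, hw, rfl⟩
    rw [hval, hval]
    exact Finset.sum_le_sum (hle w hw)
  · rintro ⟨⟨w, hw, rfl⟩, hmax⟩
    have h1 := hmax _ ⟨_, indicatorVec_mem_Icc A, rfl⟩
    rw [hval, hval] at h1
    have h2 := (Finset.sum_eq_sum_iff_of_le (hle w hw)).1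
      (le_antisymm (Finset.sum_le_sum (hle w hw)) h1)
    congr 1
    ext i
    refine mul_right_cancel₀ ?_ (h2 i (Finset.mem_univ i))
    split_ifs <;> simp

/-! ### Unique lifts and the slice at height one -/

lemma IsCubillage.eq_of_map_eq {h : k ≤ n} {Q : Set (Fin n → ℝ)} (hQ : IsCubillage h t Q)
    (ht : Function.Injective t) {q v : Fin n → ℝ} (hq : zonotopeMap t n q ∈ Q)
    (hv : zonotopeMap t n v ∈ Q) (hqv : zonotopeMap t k q = zonotopeMap t k v) : q = v :=
  zonotopeMap_injective ht (hQ.2.injOn hq hv (by rwa [proj_zonotopeMap, proj_zonotopeMap]))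

lemma IsCubillage.exists_map_eq {h : k ≤ n} {Q : Set (Fin n → ℝ)} (hQ : IsCubillage h t Q)
    {w : Fin n → ℝ} (hw : w ∈ Set.Icc (0 : Fin n → ℝ) 1) :
    ∃ q ∈ Set.Icc (0 : Fin n → ℝ) 1, zonotopeMap t n q ∈ Q ∧
      zonotopeMap t k q = zonotopeMap t k w := by
  obtain ⟨x, hxQ, hx⟩ := hQ.2.surjOn (mem_zonotope hw)
  have hxZ := hQ.1.subset hxQ
  rw [zonotope_eq_image] at hxZ
  obtain ⟨q, hq, rfl⟩ := hxZ
  exact ⟨q, hq, hxQ, by rwa [proj_zonotopeMap] at hx⟩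

lemma IsTriangulation.eq_of_map_eq {h : k ≤ n - 1} {T : Set (Fin (n - 1) → ℝ)}
    (hT : IsTriangulation h t T) (ht : Function.Injective t) {q v : Fin n → ℝ}
    (hq1 : q ∈ stdSimplex ℝ (Fin n)) (hv1 : v ∈ stdSimplex ℝ (Fin n))
    (hq : momentMap t (n - 1) q ∈ T) (hv : momentMap t (n - 1) v ∈ T)
    (hqv : zonotopeMap t (k + 1) q = zonotopeMap t (k + 1) v) : q = v := by
  refine momentMap_injOn ht hq1.2 hv1.2 (hT.2.injOn hq hv ?_)
  rw [proj_momentMap, proj_momentMap]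
  exact (zonotopeMap_eq_iff.1 hqv).2

lemma IsTriangulation.exists_map_eq {h : k ≤ n - 1} {T : Set (Fin (n - 1) → ℝ)}
    (hT : IsTriangulation h t T) {w : Fin n → ℝ} (hw : w ∈ stdSimplex ℝ (Fin n)) :
    ∃ q ∈ stdSimplex ℝ (Fin n), momentMap t (n - 1) q ∈ T ∧
      zonotopeMap t (k + 1) q = zonotopeMap t (k + 1) w := by
  obtain ⟨x, hxT, hx⟩ := hT.2.surjOn (mem_cyclicPolytope hw)
  have hxC := hT.1.subset hxT
  rw [cyclicPolytope_eq_image] at hxC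
  obtain ⟨q, hq, rfl⟩ := hxC
  rw [proj_momentMap] at hx
  exact ⟨q, hq, hxT, zonotopeMap_eq_iff.2 ⟨by rw [hq.2, hw.2], hx⟩⟩

lemma stdSimplex_subset_Icc : stdSimplex ℝ (Fin n) ⊆ Set.Icc (0 : Fin n → ℝ) 1 := fun w hw =>
  ⟨hw.1, fun i => by
    rw [Pi.one_apply, ← hw.2]
    exact Finset.single_le_sum (fun j _ => hw.1 j) (Finset.mem_univ i)⟩

lemma momentMap_mem_g_iff {Q : Set (Fin n → ℝ)} {w : Fin n → ℝ} (hw : ∑ i, w i = 1) :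
    momentMap t (n - 1) w ∈ g Q ↔ zonotopeMap t n w ∈ Q := by
  rw [g, Set.mem_preimage, intoHyperplane_momentMap hw]

lemma exists_stdSimplex_of_mem_g (hn : 0 < n) {Q : Set (Fin n → ℝ)}
    (hQ : IsSubcomplex (zonotope t n) Q) {x : Fin (n - 1) → ℝ} (hx : x ∈ g Q) :
    ∃ w ∈ stdSimplex ℝ (Fin n), x = momentMap t (n - 1) w := by
  have hxZ := hQ.subset hx
  rw [zonotope_eq_image] at hxZ
  obtain ⟨w, hw, hwx⟩ := hxZ
  have hsum := sum_eq_one_of_mem_g hn hwx.symm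
  exact ⟨w, ⟨hw.1, hsum⟩, intoHyperplane_injective (by rw [intoHyperplane_momentMap hsum, hwx])⟩

/-- The slice of a cubillage of `Z(n, δ + 1)` at height one is a triangulation of `C(n, δ)`. -/
lemma IsCubillage.isTriangulation_g (hn : 0 < n) (hδ : δ + 1 ≤ n)
    (ht : Function.Injective t) {Q : Set (Fin n → ℝ)} (hQ : IsCubillage hδ t Q) :
    IsTriangulation (Nat.le_sub_one_of_lt hδ) t (g Q) := by
  refine ⟨⟨{F | IsExposed ℝ (cyclicPolytope t (n - 1)) F ∧ F ⊆ g Q}, fun F hF => hF.1, ?_⟩, ?_⟩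
  · refine Set.Subset.antisymm (fun x hx => ?_) (Set.sUnion_subset fun F hF => hF.2)
    obtain ⟨w, hw, rfl⟩ := exists_stdSimplex_of_mem_g hn hQ.1 hx
    set A : Finset (Fin n) := {i | w i ≠ 0} with hA
    have hwA : w ∈ stdFace A := ⟨hw, fun i hi => by simpa [hA] using hi⟩
    have hAne : A.Nonempty := by
      by_contra h
      have h0 : ∑ i, w i = 0 := Finset.sum_eq_zero fun i _ =>
        hwA.2 i (by simp [Finset.not_nonempty_iff_eq_empty.1 h])
      linarith [hw.2]
    have hsub : simplex t A ⊆ g Q := by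
      rw [simplex_eq_image]
      rintro _ ⟨y, hy, rfl⟩
      rw [momentMap_mem_g_iff hw.2] at hx
      rw [momentMap_mem_g_iff hy.1.2]
      have hzero : ∀ i, w i = 0 → y i = 0 := fun i hi => hy.2 i (by simp [hA, hi])
      refine hQ.1.zonotopeMap_mem hx (stdSimplex_subset_Icc hw) (stdSimplex_subset_Icc hy.1) ?_
      rintro i (hi | hi)
      · rw [hi, hzero i hi]
      -- A simplex point with a coordinate `1` is a vertex. This is the only case in which an upper
      -- cube facet constrains `y`.
      · have hother : ∀ j, j ≠ i → w j = 0 := fun j hj => by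
          have h1 : w j + w i ≤ ∑ m, w m := by
            rw [← Finset.sum_pair hj]
            exact Finset.sum_le_sum_of_subset_of_nonneg (Finset.subset_univ _)
              fun m _ _ => hw.1 m
          have h2 := hw.1 j
          rw [hw.2] at h1
          linarith
        rw [hi, ← hy.1.2]
        exact (Finset.sum_eq_single i (fun j _ hj => hzero j (hother j hj)) (by simp)).symm
    refine ⟨simplex t A, ⟨((isFaceIn_simplex_iff hn ht hAne).2 hsub).2.1, hsub⟩, ?_⟩
    rw [simplex_eq_image]
    exact ⟨w, hwA, rfl⟩
  · refine ⟨fun x hx => ?_, fun x hx y hy hxy => ?_, fun x hx => ?_⟩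
    · obtain ⟨w, hw, rfl⟩ := exists_stdSimplex_of_mem_g hn hQ.1 hx
      rw [proj_momentMap]
      exact mem_cyclicPolytope hw
    · obtain ⟨w, hw, rfl⟩ := exists_stdSimplex_of_mem_g hn hQ.1 hx
      obtain ⟨v, hv, rfl⟩ := exists_stdSimplex_of_mem_g hn hQ.1 hy
      rw [momentMap_mem_g_iff hw.2] at hx
      rw [momentMap_mem_g_iff hv.2] at hy
      rw [proj_momentMap, proj_momentMap] at hxy
      rw [hQ.eq_of_map_eq ht hx hy (zonotopeMap_eq_iff.2 ⟨by rw [hw.2, hv.2], hxy⟩)]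
    · rw [cyclicPolytope_eq_image] at hx
      obtain ⟨w, hw, rfl⟩ := hx
      obtain ⟨q, hq, hqQ, hqw⟩ := hQ.exists_map_eq (stdSimplex_subset_Icc hw)
      have hqw' := zonotopeMap_eq_iff.1 hqw
      have hsum : ∑ i, q i = 1 := by rw [hqw'.1, hw.2]
      exact ⟨momentMap t (n - 1) q, (momentMap_mem_g_iff hsum).2 hqQ, by
        rw [proj_momentMap, hqw'.2]⟩

/-! ### Vertices of the cubillage and simplices of its slice -/

/-- The family of faces in a subcomplex need not be given as finite, but the coordinate set is a
union of cube faces, of which there are finitely many. -/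
lemma IsSubcomplex.isClosed_coords {Q : Set (Fin n → ℝ)} (hQ : IsSubcomplex (zonotope t n) Q) :
    IsClosed {q | q ∈ Set.Icc (0 : Fin n → ℝ) 1 ∧ zonotopeMap t n q ∈ Q} := by
  set X := {q | q ∈ Set.Icc (0 : Fin n → ℝ) 1 ∧ zonotopeMap t n q ∈ Q} with hX
  set face : Finset (Fin n) × Finset (Fin n) → Set (Fin n → ℝ) := fun p =>
    Set.Icc 0 1 ∩ ((⋂ i ∈ p.1, {y | y i = 0}) ∩ ⋂ i ∈ p.2, {y | y i = 1}) with hface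
  have hclosed : ∀ p, IsClosed (face p) := fun p =>
    isClosed_Icc.inter ((isClosed_biInter fun i _ =>
      isClosed_eq (continuous_apply i) continuous_const).inter
      (isClosed_biInter fun i _ => isClosed_eq (continuous_apply i) continuous_const))
  have hunion : X = ⋃ p ∈ {p | face p ⊆ X}, face p := by
    refine Set.Subset.antisymm (fun q hq => ?_) (Set.iUnion₂_subset fun p hp => hp)
    simp only [Set.mem_iUnion, Set.mem_ofPred_eq, exists_prop]
    refine ⟨(Finset.univ.filter fun i => q i = 0, Finset.univ.filter fun i => q i = 1), fun y hy => ⟨hy.1, ?_⟩, hq.1, by simp⟩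
    have h0 := hy.2.1
    have h1 := hy.2.2
    simp only [Finset.mem_filter, Finset.mem_univ, true_and, Set.mem_iInter,
      Set.mem_ofPred_eq] at h0 h1
    refine hQ.zonotopeMap_mem hq.2 hq.1 hy.1 ?_
    rintro i (hi | hi)
    · rw [hi, h0 i hi]
    · rw [hi, h1 i hi]
  rw [hunion]
  exact (Set.toFinite _).isClosed_biUnion fun p _ => hclosed p

/-- If the vertex `ξ_A` lies in a cubillage `Q` of `Z(n, δ + 1)` and `A` has `⌊δ / 2⌋ + 1`
elements, then `Q` contains the face of `Z(n, n)` spanned by the generators indexed by `A`, so that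
`g Q` contains `|A|`. -/
lemma IsCubillage.simplex_subset_g (ht : Function.Injective t) {h : δ + 1 ≤ n}
    {Q : Set (Fin n → ℝ)} (hQ : IsCubillage h t Q) {A : Finset (Fin n)} (hA : #A = δ / 2 + 1)
    (hAQ : xi t A ∈ Q) : simplex t A ⊆ g Q := by
  rw [← zonotopeMap_indicatorVec] at hAQ
  set M := zonotopeMap t (δ + 1) with hM
  -- The part of `Q` far from `ξ_A`: its projection is compact and misses that of `ξ_A`, so lifts of
  -- nearby points must be near `ξ_A`.
  set K : Set (Fin n → ℝ) := {q | q ∈ Set.Icc (0 : Fin n → ℝ) 1 ∧ zonotopeMap t n q ∈ Q} ∩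
    ⋃ i, {q | 1 / 2 ≤ |q i - indicatorVec A i|} with hK
  have hKclosed : IsClosed K := hQ.1.isClosed_coords.inter <| isClosed_iUnion_of_finite fun i =>
    isClosed_le continuous_const (by fun_prop)
  have hKcompact : IsCompact K := isCompact_Icc.of_isClosed_subset hKclosed fun q hq => hq.1.1
  have hMK : IsClosed (M '' K) := (hKcompact.image M.continuous_of_finiteDimensional).isClosed
  have hnot : M (indicatorVec A) ∉ M '' K := by
    rintro ⟨q, hq, hqA⟩
    obtain ⟨i, hi⟩ := Set.mem_iUnion.1 hq.2
    rw [hQ.eq_of_map_eq ht hq.1.2 hAQ hqA] at hi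
    norm_num at hi
  have hcont : Continuous fun s : ℝ => s • M (indicatorVec A) := by fun_prop
  have hev : ∀ᶠ s in nhdsWithin (1 : ℝ) (Set.Iio 1), s • M (indicatorVec A) ∈ (M '' K)ᶜ := by
    refine Filter.Eventually.filter_mono nhdsWithin_le_nhds
      (hcont.continuousAt.eventually_mem (hMK.isOpen_compl.mem_nhds ?_))
    simpa using hnot
  obtain ⟨s, hsK, hs0, hs1⟩ := (hev.and (Ioo_mem_nhdsLT (zero_lt_one' ℝ))).exists
  have hsA : s • indicatorVec A ∈ Set.Icc (0 : Fin n → ℝ) 1 := by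
    constructor <;> intro i <;> simp only [indicatorVec, Pi.smul_apply, smul_eq_mul] <;>
      split_ifs <;> simp [hs0.le, hs1.le]
  obtain ⟨q, hq, hqQ, hqs⟩ := hQ.exists_map_eq hsA
  have hnear : ∀ i, |q i - indicatorVec A i| < 1 / 2 := by
    intro i
    by_contra! hi
    exact hsK ⟨q, ⟨⟨hq, hqQ⟩, Set.mem_iUnion.2 ⟨i, hi⟩⟩, by rw [hM, hqs, map_smul]⟩
  have hle : ∀ a ∈ A, q a ≤ s := fun a ha => by
    by_contra! hlt
    have hker : M (s • indicatorVec A - q) = 0 := by rw [map_sub, hM, hqs, sub_self]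
    have hne : s • indicatorVec A - q ≠ 0 := fun h0 => by
      have := congrFun h0 a
      simp only [indicatorVec, Pi.sub_apply, Pi.smul_apply, if_pos ha, smul_eq_mul, mul_one,
        Pi.zero_apply] at this
      linarith
    -- If `q a > s`, the positive coefficients lie in `A \ {a}`, one element too few.
    have := half_lt_card_pos ht hker hne (A := A.erase a) fun i hi => by
      by_cases hia : i = a
      · subst hia
        simp only [indicatorVec, Pi.sub_apply, Pi.smul_apply, if_pos ha, smul_eq_mul, mul_one]
        linarith
      · have hiA : i ∉ A := fun h => hi (Finset.mem_erase.2 ⟨hia, h⟩)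
        have := hq.1 i
        simp only [Pi.zero_apply] at this
        simpa [indicatorVec, hiA] using this
    rw [Finset.card_erase_of_mem ha] at this
    omega
  rw [simplex_eq_image]
  rintro _ ⟨y, hy, rfl⟩
  rw [momentMap_mem_g_iff hy.1.2]
  -- On `A`, `q` lies strictly between `0` and `1`; off `A`, `q` is below `1/2`. So the smallest
  -- face only forces zeros off `A`.
  refine hQ.1.zonotopeMap_mem hqQ hq (stdSimplex_subset_Icc hy.1) fun i hi => ?_
  have hi2 := abs_lt.1 (hnear i)
  by_cases hiA : i ∈ A
  · have hqi := hle i hiA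
    simp only [indicatorVec, if_pos hiA] at hi2
    rcases hi with hi | hi <;> linarith
  · simp only [indicatorVec, if_neg hiA] at hi2
    rcases hi with hi | hi
    · rw [hi, hy.2 i hiA]
    · linarith

lemma xi_mem_of_simplex_subset_g {Q : Set (Fin n → ℝ)} (hQ : IsSubcomplex (zonotope t n) Q)
    {A : Finset (Fin n)} (hA : A.Nonempty) (h : simplex t A ⊆ g Q) : xi t A ∈ Q := by
  have hpos : (0 : ℝ) < #A := by exact_mod_cast hA.card_pos
  have hval : ∀ i, ((#A : ℝ)⁻¹ • indicatorVec A) i = if i ∈ A then (#A : ℝ)⁻¹ else 0 := by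
    intro i
    simp [indicatorVec]
  have hb : (#A : ℝ)⁻¹ • indicatorVec A ∈ stdFace A := by
    refine ⟨⟨fun i => ?_, ?_⟩, fun i hi => ?_⟩
    · rw [hval]; split_ifs <;> positivity
    · simp only [hval, Finset.sum_ite_mem, Finset.univ_inter, Finset.sum_const, nsmul_eq_mul]
      exact mul_inv_cancel₀ hpos.ne'
    · rw [hval, if_neg hi]
  rw [simplex_eq_image] at h
  have hbQ := (momentMap_mem_g_iff hb.1.2).1 (h ⟨_, hb, rfl⟩)
  rw [← zonotopeMap_indicatorVec]
  refine hQ.zonotopeMap_mem hbQ (stdSimplex_subset_Icc hb.1) (indicatorVec_mem_Icc A) fun i hi => ?_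
  rw [hval] at hi ⊢
  by_cases hiA : i ∈ A
  -- A barycentric coordinate on `A` can be `1` only if `A` is a singleton, and then the barycentre
  -- is `ξ_A` itself.
  · simp only [if_pos hiA, inv_eq_zero, hpos.ne', false_or] at hi
    simp [indicatorVec, hiA, hi]
  · simp [indicatorVec, hiA]

/-! ### Supporting polynomials and facets -/

/-- Some polynomial of degree at most `δ` is non-negative at all `tᵢ`, zero at those indexed by
`A`, and not zero at all of them. -/
def HasSupportingPolynomial (t : Fin n → ℝ) (δ : ℕ) (A : Finset (Fin n)) : Prop :=
  ∃ f : ℝ[X], f.natDegree ≤ δ ∧ (∀ i, 0 ≤ f.eval (t i)) ∧ (∀ i ∈ A, f.eval (t i) = 0) ∧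
    ∃ i, f.eval (t i) ≠ 0

/-- The ratio test: increase `c` until the first coordinate reaches zero. It serves both to tilt
supporting polynomials and to shrink dependences. -/
lemma exists_add_mul_nonneg {ι : Type*} [Fintype ι] {a h : ι → ℝ} (ha : ∀ i, 0 ≤ a i)
    (hah : ∀ i, a i = 0 → h i = 0) (hneg : ∃ j, h j < 0) :
    ∃ c : ℝ, (∀ i, 0 ≤ a i + c * h i) ∧ ∃ j, a j ≠ 0 ∧ a j + c * h j = 0 := by
  obtain ⟨j₀, hj₀⟩ := hneg
  obtain ⟨j, hj, hmin⟩ := Finset.exists_min_image {i | h i < 0} (fun i => a i / -h i)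
    ⟨j₀, by simpa using hj₀⟩
  simp only [Finset.mem_filter, Finset.mem_univ, true_and] at hj hmin
  refine ⟨a j / -h j, fun i => ?_, j, fun h0 => hj.ne (hah j h0), ?_⟩
  · have hc : 0 ≤ a j / -h j := div_nonneg (ha j) (by linarith)
    by_cases hi : h i < 0
    · have := (le_div_iff₀ (by linarith : (0 : ℝ) < -h i)).1 (hmin i hi)
      linarith
    · exact add_nonneg (ha i) (mul_nonneg hc (not_lt.1 hi))
  · rw [div_neg, neg_mul, div_mul_cancel₀ _ hj.ne]
    ring

lemma card_zeros_le (ht : Function.Injective t) {f : ℝ[X]} (hf : f.natDegree ≤ δ) {i : Fin n}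
    (hi : f.eval (t i) ≠ 0) {S : Finset (Fin n)} (hS : ∀ j ∈ S, f.eval (t j) = 0) : #S ≤ δ := by
  by_contra! hlt
  have : f = 0 := eq_zero_of_natDegree_lt_card_of_eval_eq_zero' f (S.image t)
    (by simpa using hS) (by rw [Finset.card_image_of_injective _ ht]; omega)
  simp [this] at hi

/-- A supporting polynomial can be tilted until it vanishes at `δ` of the `tᵢ`. -/
lemma HasSupportingPolynomial.exists_card_eq (ht : Function.Injective t) (hδ : δ + 1 ≤ n)
    {A : Finset (Fin n)} (hA : HasSupportingPolynomial t δ A) :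
    ∃ f : ℝ[X], f.natDegree ≤ δ ∧ (∀ i, 0 ≤ f.eval (t i)) ∧
      ∃ S : Finset (Fin n), A ⊆ S ∧ #S = δ ∧ ∀ i, i ∈ S ↔ f.eval (t i) = 0 := by
  obtain ⟨f, hf, hf0, hfA, hfi⟩ := hA
  obtain ⟨m, hm⟩ : ∃ m, m = δ - #{i | f.eval (t i) = 0} := ⟨_, rfl⟩
  induction m using Nat.strong_induction_on generalizing f with
  | _ m ih =>
  set S : Finset (Fin n) := {i | f.eval (t i) = 0} with hS
  have hSmem : ∀ i, i ∈ S ↔ f.eval (t i) = 0 := fun i => by simp [hS]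
  obtain ⟨i, hi⟩ := hfi
  have hcard : #S ≤ δ := card_zeros_le ht hf hi fun j hj => (hSmem j).1 hj
  rcases hcard.eq_or_lt with hcard | hcard
  · exact ⟨f, hf, hf0, S, fun a ha => (hSmem a).2 (hfA a ha), hcard, hSmem⟩
  -- The root added at `j₀` keeps the value there fixed and non-zero, so the tilted polynomial never
  -- vanishes at all nodes; `j₁` provides a direction in which to tilt.
  obtain ⟨j₀, hj₀, j₁, hj₁, hne⟩ := Finset.one_lt_card.1
    (show 1 < #Sᶜ by rw [Finset.card_compl, Fintype.card_fin]; omega)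
  rw [Finset.mem_compl] at hj₀ hj₁
  set P : ℝ[X] := ∏ i ∈ insert j₀ S, (X - C (t i)) with hP
  have hPz : ∀ j, P.eval (t j) = 0 ↔ j ∈ insert j₀ S := fun j => eval_prod_X_sub_C_eq_zero_iff ht
  have hPdeg : P.natDegree ≤ δ := by
    rw [hP, natDegree_prod_of_monic _ _ fun i _ => monic_X_sub_C _]
    simp [Finset.card_insert_of_notMem hj₀]
    omega
  have hP₁ : P.eval (t j₁) ≠ 0 := by
    rw [Ne, hPz]
    simp [hne.symm, hj₁]
  -- The factor `-P.eval (t j₁)` makes the perturbation negative at `j₁`.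
  obtain ⟨c, hc, j, hj, hjc⟩ := exists_add_mul_nonneg (a := fun i => f.eval (t i))
    (h := fun i => -P.eval (t j₁) * P.eval (t i)) hf0
    (fun i hi => by rw [(hPz i).2 (Finset.mem_insert_of_mem ((hSmem i).2 hi)), mul_zero])
    ⟨j₁, by nlinarith [mul_self_pos.2 hP₁]⟩
  set f' : ℝ[X] := f + C (c * -P.eval (t j₁)) * P with hf'
  have heval : ∀ i, f'.eval (t i) = f.eval (t i) + c * (-P.eval (t j₁) * P.eval (t i)) := by
    intro i
    simp [hf']
    ring
  have hzero : ∀ i, f.eval (t i) = 0 → f'.eval (t i) = 0 := fun i hi => by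
    rw [heval, hi, (hPz i).2 (Finset.mem_insert_of_mem ((hSmem i).2 hi))]
    simp
  have hlt : #S < #{i | f'.eval (t i) = 0} := by
    refine Finset.card_lt_card ⟨fun i hi => ?_, fun h => hj ?_⟩
    · simpa using hzero i ((hSmem i).1 hi)
    · exact (hSmem j).1 (h (by simpa [heval] using hjc))
  refine ih _ ?_ f' ?_ (fun i => by rw [heval]; exact hc i) (fun a ha => hzero a (hfA a ha))
    ⟨j₀, ?_⟩ rfl
  · omega
  · exact (natDegree_add_le _ _).trans (max_le hf ((natDegree_C_mul_le _ _).trans hPdeg))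
  · rw [heval, (hPz j₀).2 (Finset.mem_insert_self _ _)]
    simpa using fun h => hj₀ ((hSmem j₀).2 h)

/-- At most `k + 1` points of the moment curve in `ℝᵏ` are affinely independent. -/
lemma affineIndependent_moment (ht : Function.Injective t) {S : Finset (Fin n)}
    (hS : #S ≤ k + 1) : AffineIndependent ℝ fun i : S => moment k (t i) := by
  rw [affineIndependent_iff]
  intro s w hw hwm e he
  set W : Fin n → ℝ := ∑ e ∈ s, w e • Pi.single (e : Fin n) 1 with hW
  have hWapply : ∀ i, W i = ∑ e ∈ s, if i = (e : Fin n) then w e else 0 := fun i => by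
    simp [hW, Finset.sum_apply, Pi.single_apply]
  have hker : zonotopeMap t (k + 1) W = 0 := by
    rw [← map_zero (zonotopeMap t (k + 1)), zonotopeMap_eq_iff]
    constructor
    · simp only [hWapply, Pi.zero_apply, Finset.sum_const_zero]
      rw [Finset.sum_comm]
      simpa using hw
    · simp [hW, map_sum, momentMap_single, hwm]
  have hzero := eq_zero_of_zonotopeMap_eq_zero ht hker hS fun i hi => by
    rw [hWapply]
    refine Finset.sum_eq_zero fun e _ => if_neg ?_
    rintro rfl
    exact hi e.2
  have := congrFun hzero e
  rw [hWapply, Finset.sum_eq_single e] at this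
  · simpa using this
  · intro b _ hb
    exact if_neg fun h => hb (Subtype.ext h.symm)
  · exact fun h => absurd he h

lemma finrank_vectorSpan_image_stdFace (ht : Function.Injective t) {S : Finset (Fin n)} {m : ℕ}
    (hS : #S = m + 1) (hm : m ≤ k) :
    Module.finrank ℝ (vectorSpan ℝ (momentMap t k '' stdFace S)) = m := by
  rw [← convexHull_moment_image, ← direction_affineSpan, affineSpan_convexHull,
    direction_affineSpan]
  have h := (affineIndependent_moment ht (k := k) (by omega : #S ≤ k + 1)).finrank_vectorSpan
    (n := m) (by simpa using hS)
  have hrange : (fun i => moment k (t i)) '' (S : Set (Fin n)) =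
      Set.range fun i : S => moment k (t i) := by
    ext x
    simp
  rw [hrange, h]

lemma finrank_vectorSpan_cyclicPolytope (ht : Function.Injective t) (hk : k + 1 ≤ n) :
    Module.finrank ℝ (vectorSpan ℝ (cyclicPolytope t k)) = k := by
  obtain ⟨S, -, hS⟩ := Finset.exists_subset_card_eq (s := (Finset.univ : Finset (Fin n)))
    (n := k + 1) (by simpa using hk)
  refine le_antisymm ((Submodule.finrank_le _).trans (by simp)) ?_
  have hsub : momentMap t k '' stdFace S ⊆ cyclicPolytope t k := by
    rw [cyclicPolytope_eq_image]
    exact Set.image_mono fun w hw => hw.1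
  have h := Submodule.finrank_mono (vectorSpan_mono ℝ hsub)
  rwa [finrank_vectorSpan_image_stdFace ht hS le_rfl] at h

lemma HasSupportingPolynomial.not_isInternalSimplex (ht : Function.Injective t) (hδ : δ + 1 ≤ n)
    {A : Finset (Fin n)} (hAne : A.Nonempty) (hA : HasSupportingPolynomial t δ A) :
    ¬ IsInternalSimplex (Nat.le_sub_one_of_lt hδ) t A := by
  obtain ⟨f, hf, hf0, S, hAS, hS, hSf⟩ := hA.exists_card_eq ht hδ
  obtain ⟨a, ha⟩ := hAne
  -- Since `#S = δ`, this excludes `δ = 0`, where `δ - 1` would truncate.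
  have hpos : 0 < #S := Finset.card_pos.2 ⟨a, hAS ha⟩
  refine not_not.2 ⟨momentMap t δ '' stdFace S, ⟨?_, ?_, ?_⟩, ?_⟩
  · exact ⟨_, _, single_mem_stdFace (hAS ha), rfl⟩
  · exact isExposed_momentMap_image_stdFace hf hf0 hSf
  · rw [finrank_vectorSpan_cyclicPolytope ht hδ,
      finrank_vectorSpan_image_stdFace ht (m := δ - 1) (by omega) (by omega)]
    omega
  · rw [simplex_eq_image]
    rintro _ ⟨_, ⟨w, hw, rfl⟩, rfl⟩
    rw [proj_momentMap]
    exact ⟨w, ⟨hw.1, fun i hi => hw.2 i fun h => hi (hAS h)⟩, rfl⟩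

lemma exists_polynomial_eval_eq_moment (l : (Fin k → ℝ) →ₗ[ℝ] ℝ) :
    ∃ f : ℝ[X], f.natDegree ≤ k ∧ ∀ s, f.eval s = l (moment k s) := by
  refine ⟨∑ i : Fin k, C (l fun j => if i = j then 1 else 0) * X ^ ((i : ℕ) + 1), ?_, fun s => ?_⟩
  · exact natDegree_sum_le_of_forall_le _ _ fun i _ => (natDegree_C_mul_X_pow_le _ _).trans i.2
  · rw [LinearMap.pi_apply_eq_sum_univ l (moment k s), eval_finsetSum]
    refine Finset.sum_congr rfl fun i _ => ?_
    rw [eval_mul, eval_C, eval_pow, eval_X, smul_eq_mul, mul_comm]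
    rfl

lemma exists_polynomial_eval_eq_veronese (l : (Fin (k + 1) → ℝ) →ₗ[ℝ] ℝ) :
    ∃ f : ℝ[X], f.natDegree ≤ k ∧ ∀ s, f.eval s = l (veronese (k + 1) s) := by
  refine ⟨∑ i : Fin (k + 1), C (l fun j => if i = j then 1 else 0) * X ^ (i : ℕ), ?_, fun s => ?_⟩
  · exact natDegree_sum_le_of_forall_le _ _ fun i _ =>
      (natDegree_C_mul_X_pow_le _ _).trans (Nat.lt_succ_iff.1 i.2)
  · rw [LinearMap.pi_apply_eq_sum_univ l (veronese (k + 1) s), eval_finsetSum]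
    refine Finset.sum_congr rfl fun i _ => ?_
    rw [eval_mul, eval_C, eval_pow, eval_X, smul_eq_mul, mul_comm]
    rfl

lemma hasSupportingPolynomial_of_not_isInternalSimplex {h : δ ≤ n - 1} {A : Finset (Fin n)}
    (hAne : A.Nonempty) (hA : ¬ IsInternalSimplex h t A) : HasSupportingPolynomial t δ A := by
  obtain ⟨F, ⟨hFne, hFe, hFr⟩, hAF⟩ := not_not.1 hA
  obtain ⟨l, rfl⟩ := hFe hFne
  obtain ⟨a, ha⟩ := hAne
  obtain ⟨f, hf, hfl⟩ := exists_polynomial_eval_eq_moment (l : (Fin δ → ℝ) →ₗ[ℝ] ℝ)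
  simp only [ContinuousLinearMap.coe_coe] at hfl
  have hmem : ∀ i ∈ A, ∀ y ∈ cyclicPolytope t δ, l y ≤ f.eval (t i) := fun i hi => by
    rw [simplex_eq_image] at hAF
    have := (hAF ⟨_, ⟨_, single_mem_stdFace hi, rfl⟩, rfl⟩).2
    rwa [proj_momentMap, momentMap_single, ← hfl] at this
  have hvert : ∀ i, moment δ (t i) ∈ cyclicPolytope t δ := fun i =>
    subset_convexHull ℝ _ ⟨i, rfl⟩
  have hle : ∀ i, f.eval (t i) ≤ f.eval (t a) := fun i => by
    rw [hfl (t i)]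
    exact hmem a ha _ (hvert i)
  refine ⟨C (f.eval (t a)) - f, ?_, fun i => ?_, fun i hi => ?_, ?_⟩
  · exact (natDegree_sub_le _ _).trans (max_le (by simp) hf)
  · simpa using hle i
  · have := hmem i hi _ (hvert a)
    rw [← hfl] at this
    simp [le_antisymm this (hle i)]
  -- If `l` were constant on the vertices, the exposed face would be the whole polytope,
  -- contradicting codimension one.
  · by_contra! hall
    have hconst : ∀ y ∈ cyclicPolytope t δ, l y = f.eval (t a) := fun y hy => by
      rw [cyclicPolytope_eq_image] at hy
      obtain ⟨w, hw, rfl⟩ := hy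
      have hmm := map_momentMap (t := t) (l : (Fin δ → ℝ) →ₗ[ℝ] ℝ) w
      simp only [ContinuousLinearMap.coe_coe] at hmm
      rw [hmm]
      calc ∑ i, w i * l (moment δ (t i)) = ∑ i, w i * f.eval (t a) := by
            refine Finset.sum_congr rfl fun i _ => ?_
            have := hall i
            rw [eval_sub, eval_C, sub_eq_zero] at this
            rw [← hfl, this]
        _ = f.eval (t a) := by rw [← Finset.sum_mul, hw.2, one_mul]
    have hF : {x ∈ cyclicPolytope t δ | ∀ y ∈ cyclicPolytope t δ, l y ≤ l x} =
        cyclicPolytope t δ := by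
      ext x
      refine ⟨fun hx => hx.1, fun hx => ⟨hx, fun y hy => ?_⟩⟩
      rw [hconst x hx, hconst y hy]
    rw [hF] at hFr
    omega

lemma not_isInternalSimplex_iff (ht : Function.Injective t) (hδ : δ + 1 ≤ n)
    {A : Finset (Fin n)} (hA : A.Nonempty) :
    ¬ IsInternalSimplex (Nat.le_sub_one_of_lt hδ) t A ↔ HasSupportingPolynomial t δ A :=
  ⟨hasSupportingPolynomial_of_not_isInternalSimplex hA, fun h => h.not_isInternalSimplex ht hδ hA⟩

/-! ### Supporting polynomials and the interior of the zonotope -/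

/-- The polynomial is a functional that is non-negative on the zonotope and zero at this point;
subtracting a small multiple of a generator on which it is positive leaves the zonotope. -/
lemma HasSupportingPolynomial.notMem_interior {A : Finset (Fin n)}
    (hA : HasSupportingPolynomial t δ A) :
    zonotopeMap t (δ + 1) (indicatorVec A) ∉ interior (zonotope t (δ + 1)) := by
  obtain ⟨f, hf, hf0, hfA, j, hj⟩ := hA
  intro hint
  have hval : ∀ w : Fin n → ℝ, coeffFunctional f (δ + 1) (zonotopeMap t (δ + 1) w) =
      ∑ i, w i * f.eval (t i) := fun w => by
    simp [map_zonotopeMap, coeffFunctional_veronese (Nat.lt_succ_of_le hf)]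
  have hnonneg : ∀ y ∈ zonotope t (δ + 1), 0 ≤ coeffFunctional f (δ + 1) y := by
    rw [zonotope_eq_image]
    rintro _ ⟨w, hw, rfl⟩
    rw [hval]
    exact Finset.sum_nonneg fun i _ => mul_nonneg (hw.1 i) (hf0 i)
  have hcont : Continuous fun s : ℝ =>
      zonotopeMap t (δ + 1) (indicatorVec A) - s • veronese (δ + 1) (t j) := by fun_prop
  have hev : ∀ᶠ s in nhdsWithin (0 : ℝ) (Set.Ioi 0),
      zonotopeMap t (δ + 1) (indicatorVec A) - s • veronese (δ + 1) (t j) ∈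
        interior (zonotope t (δ + 1)) :=
    Filter.Eventually.filter_mono nhdsWithin_le_nhds
      (hcont.continuousAt.eventually_mem (isOpen_interior.mem_nhds (by simpa using hint)))
  obtain ⟨s, hs, hs0⟩ := (hev.and self_mem_nhdsWithin).exists
  have h := hnonneg _ (interior_subset hs)
  have hA0 : ∑ i, indicatorVec A i * f.eval (t i) = 0 := Finset.sum_eq_zero fun i _ => by
    by_cases hi : i ∈ A
    · rw [hfA i hi, mul_zero]
    · simp [indicatorVec, hi]
  rw [map_sub, hval, hA0, map_smul, coeffFunctional_veronese (Nat.lt_succ_of_le hf),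
    smul_eq_mul] at h
  have := mul_pos (Set.mem_Ioi.1 hs0) (lt_of_le_of_ne (hf0 j) (Ne.symm hj))
  linarith

/-- If `M 1_A` is not a positive combination of all the generators, then a supporting polynomial
exists. -/
lemma hasSupportingPolynomial_of_forall_pos (ht : Function.Injective t)
    (hδ : δ + 1 ≤ n) {A : Finset (Fin n)}
    (hA : ∀ w : Fin n → ℝ, (∀ i, 0 < w i) →
      zonotopeMap t (δ + 1) w ≠ zonotopeMap t (δ + 1) (indicatorVec A)) :
    HasSupportingPolynomial t δ A := by
  set U : Set (Fin n → ℝ) := Set.univ.pi fun _ => Set.Ioi 0 with hU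
  have hUopen : IsOpen U := isOpen_set_pi Set.finite_univ fun _ _ => isOpen_Ioi
  have hUconv : Convex ℝ U := convex_pi fun _ _ => convex_Ioi 0
  obtain ⟨l, hl⟩ := geometric_hahn_banach_open_point
    (hUconv.linear_image (zonotopeMap t (δ + 1)))
    ((zonotopeMap t (δ + 1)).isOpenMap_of_finiteDimensional (zonotopeMap_surjective ht hδ) _ hUopen)
    (x := zonotopeMap t (δ + 1) (indicatorVec A))
    (by rintro ⟨w, hw, hwA⟩; exact hA w (fun i => hw i trivial) hwA)
  obtain ⟨f, hf, hfl⟩ := exists_polynomial_eval_eq_veronese (l : (Fin (δ + 1) → ℝ) →ₗ[ℝ] ℝ)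
  have hval : ∀ w : Fin n → ℝ, l (zonotopeMap t (δ + 1) w) = ∑ i, w i * f.eval (t i) := fun w => by
    simpa [hfl] using map_zonotopeMap (t := t) (l : (Fin (δ + 1) → ℝ) →ₗ[ℝ] ℝ) w
  have hlt : ∀ w : Fin n → ℝ, (∀ i, 0 < w i) →
      ∑ i, w i * f.eval (t i) < ∑ i ∈ A, f.eval (t i) := fun w hw => by
    have := hl _ ⟨w, fun i _ => hw i, rfl⟩
    rw [hval, hval] at this
    simpa [indicatorVec, Finset.sum_ite_mem] using this
  have hnonpos : ∀ j, f.eval (t j) ≤ 0 := fun j => by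
    by_contra! hj
    -- The extra weight `|K| / f.eval (t j)` at `j` adds `|K|` to the sum, enough to violate the
    -- bound `hlt`.
    set K := ∑ i ∈ A, f.eval (t i) - ∑ i, f.eval (t i) with hK
    have hs : 0 ≤ |K| / f.eval (t j) := by positivity
    have := hlt (fun i => 1 + if i = j then |K| / f.eval (t j) else 0) fun i => by
      split_ifs <;> positivity
    simp only [add_mul, one_mul, Finset.sum_add_distrib, ite_mul, zero_mul, Finset.sum_ite_eq',
      Finset.mem_univ, if_true, div_mul_cancel₀ _ hj.ne'] at this
    linarith [le_abs_self K]
  have hsumA : 0 ≤ ∑ i ∈ A, f.eval (t i) := by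
    by_contra! hneg
    -- A small uniform weight makes the left side of `hlt` close to `0`, above a negative right
    -- side.
    set K := ∑ i, f.eval (t i) with hK
    have hK0 : K ≤ 0 := Finset.sum_nonpos fun i _ => hnonpos i
    have hden : 0 < 1 - K := by linarith
    have := hlt (fun _ => -(∑ i ∈ A, f.eval (t i)) / (1 - K)) fun i =>
      div_pos (by linarith) hden
    rw [← Finset.mul_sum, ← hK, div_mul_eq_mul_div, div_lt_iff₀ hden] at this
    linarith
  have hzero := (Finset.sum_eq_zero_iff_of_nonpos fun i _ => hnonpos i).1
    (le_antisymm (Finset.sum_nonpos fun i _ => hnonpos i) hsumA)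
  refine ⟨-f, by rwa [natDegree_neg], fun i => by simpa using hnonpos i,
    fun i hi => by simpa using hzero i hi, ?_⟩
  by_contra! hall
  have := hlt (fun _ => 1) fun _ => one_pos
  simp only [eval_neg, neg_eq_zero] at hall
  simp [hall] at this

/-- For `A` with `⌊δ / 2⌋ + 1` elements, `ξ_A` projects into the interior of `Z(n, δ + 1)` if and
only if there is no supporting polynomial for `A`. -/
lemma mem_interior_zonotope_iff (hn : 2 ≤ n) (ht : Function.Injective t)
    (hδ : δ + 1 ≤ n) {A : Finset (Fin n)} (hA : #A = δ / 2 + 1) :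
    zonotopeMap t (δ + 1) (indicatorVec A) ∈ interior (zonotope t (δ + 1)) ↔
      ¬ HasSupportingPolynomial t δ A := by
  refine ⟨fun h hsupp => hsupp.notMem_interior h, fun h => ?_⟩
  obtain ⟨w, hw0, hw⟩ : ∃ w : Fin n → ℝ, (∀ i, 0 < w i) ∧
      zonotopeMap t (δ + 1) w = zonotopeMap t (δ + 1) (indicatorVec A) := by
    by_contra! hcon
    exact h (hasSupportingPolynomial_of_forall_pos ht hδ hcon)
  have hker : zonotopeMap t (δ + 1) (indicatorVec A - w) = 0 := by rw [map_sub, hw, sub_self]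
  have hoff : ∀ i ∉ A, (indicatorVec A - w) i < 0 := fun i hi => by
    simpa [indicatorVec, hi] using hw0 i
  have hne : indicatorVec A - w ≠ 0 := fun h0 => by
    -- Here `2 ≤ n` matters: it gives `δ / 2 + 1 < n`.
    obtain ⟨j, hj⟩ : ∃ j, j ∉ A := by
      by_contra! hall
      have := Finset.card_eq_of_equiv_fin (Equiv.subtypeUnivEquiv hall)
      omega
    have := hoff j hj
    rw [h0] at this
    exact lt_irrefl _ this
  have hon : ∀ a ∈ A, w a < 1 := fun a ha => by
    by_contra! hlt
    have := half_lt_card_pos ht hker hne (A := A.erase a) fun i hi => by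
      by_cases hia : i = a
      · subst hia
        simpa [indicatorVec, ha] using hlt
      · exact (hoff i fun h => hi (Finset.mem_erase.2 ⟨hia, h⟩)).le
    rw [Finset.card_erase_of_mem ha] at this
    omega
  set V : Set (Fin n → ℝ) := Set.univ.pi fun _ => Set.Ioo 0 1 with hV
  have hVopen : IsOpen V := isOpen_set_pi Set.finite_univ fun _ _ => isOpen_Ioo
  refine interior_maximal (s := zonotope t (δ + 1)) (t := zonotopeMap t (δ + 1) '' V) ?_
    ((zonotopeMap t (δ + 1)).isOpenMap_of_finiteDimensional (zonotopeMap_surjective ht hδ)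
      _ hVopen) ?_
  · rintro _ ⟨v, hv, rfl⟩
    exact mem_zonotope ⟨fun i => (hv i trivial).1.le, fun i => (hv i trivial).2.le⟩
  · have hwW : ∀ i, w i ≤ ∑ i, w i := fun i =>
      Finset.single_le_sum (fun i _ => (hw0 i).le) (Finset.mem_univ i)
    have hW : 0 < 1 + ∑ i, w i := add_pos_of_pos_of_nonneg one_pos
      (Finset.sum_nonneg fun i _ => (hw0 i).le)
    -- Move from `1_A` a short way towards `w` within the fibre. The step length is small enough to
    -- bring every coordinate strictly between `0` and `1`.
    refine ⟨indicatorVec A - (1 + ∑ i, w i)⁻¹ • (indicatorVec A - w), fun i _ => ?_, by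
      rw [map_sub, map_smul, hker, smul_zero, sub_zero]⟩
    by_cases hi : i ∈ A
    · have h1 : 0 < (1 + ∑ i, w i)⁻¹ * (1 - w i) :=
        mul_pos (inv_pos.2 hW) (by linarith [hon i hi])
      have h2 : (1 + ∑ i, w i)⁻¹ * (1 - w i) < 1 := by
        rw [inv_mul_lt_iff₀ hW]
        linarith [hw0 i, hwW i]
      simp only [indicatorVec, Pi.sub_apply, Pi.smul_apply, if_pos hi, smul_eq_mul, Set.mem_Ioo]
      constructor <;> linarith
    · have h1 : 0 < (1 + ∑ i, w i)⁻¹ * w i := mul_pos (inv_pos.2 hW) (hw0 i)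
      have h2 : (1 + ∑ i, w i)⁻¹ * w i < 1 := by
        rw [inv_mul_lt_iff₀ hW]
        linarith [hwW i]
      simp only [indicatorVec, Pi.sub_apply, Pi.smul_apply, if_neg hi, smul_eq_mul, Set.mem_Ioo]
      constructor <;> linarith

/-! ### Triangulations are determined by their internal simplices -/

/-- Every triangulation contains all simplices on the boundary. -/
lemma IsTriangulation.simplex_subset_of_hasSupportingPolynomial {h : δ ≤ n - 1}
    {T : Set (Fin (n - 1) → ℝ)} (hT : IsTriangulation h t T) (ht : Function.Injective t)
    {A : Finset (Fin n)} (hA : HasSupportingPolynomial t δ A) : simplex t A ⊆ T := by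
  obtain ⟨f, hf, hf0, hfA, j, hj⟩ := hA
  rw [simplex_eq_image]
  rintro _ ⟨p, hp, rfl⟩
  obtain ⟨q, hq, hqT, hqp⟩ := hT.exists_map_eq hp.1
  have hker : zonotopeMap t (δ + 1) (q - p) = 0 := by rw [map_sub, hqp, sub_self]
  have hpf : ∀ i, p i * f.eval (t i) = 0 := fun i => by
    by_cases hi : i ∈ A
    · rw [hfA i hi, mul_zero]
    · rw [hp.2 i hi, zero_mul]
  have hsum := sum_mul_eval_eq_zero hker (Nat.lt_succ_of_le hf)
  simp only [Pi.sub_apply, sub_mul, hpf, sub_zero] at hsum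
  have hqf := (Finset.sum_eq_zero_iff_of_nonneg fun i _ => mul_nonneg (hq.1 i) (hf0 i)).1 hsum
  set S : Finset (Fin n) := {i | f.eval (t i) = 0} with hS
  have hScard : #S ≤ δ := card_zeros_le ht hf hj (by simp [hS])
  -- Both `p` and its lift `q` are supported on the at most `δ` zeros of `f`, whose Veronese vectors
  -- are independent.
  have hzero := eq_zero_of_zonotopeMap_eq_zero ht hker (S := S) (by omega) fun i hi => by
    have hi' : f.eval (t i) ≠ 0 := by simpa [hS] using hi
    rw [Pi.sub_apply, (mul_eq_zero.1 (hpf i)).resolve_right hi',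
      (mul_eq_zero.1 (hqf i (Finset.mem_univ i))).resolve_right hi', sub_zero]
  rwa [← sub_eq_zero.1 hzero]

lemma exists_ne_zero_of_card_lt {S : Finset (Fin n)} (hS : k < #S) :
    ∃ u : Fin n → ℝ, u ≠ 0 ∧ zonotopeMap t k u = 0 ∧ ∀ i ∉ S, u i = 0 := by
  have hlt : Module.finrank ℝ ((Fin k → ℝ) × ({i // i ∉ S} → ℝ)) <
      Module.finrank ℝ (Fin n → ℝ) := by
    have := S.card_le_univ
    simp only [Module.finrank_prod, Module.finrank_fintype_fun_eq_card, Fintype.card_fin,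
      Fintype.card_subtype_compl, Fintype.card_coe] at this ⊢
    omega
  obtain ⟨u, hu, hu0⟩ := Submodule.exists_mem_ne_zero_of_ne_bot
    (LinearMap.ker_ne_bot_of_finrank_lt
      (f := (zonotopeMap t k).prod (LinearMap.funLeft ℝ ℝ (Subtype.val : {i // i ∉ S} → Fin n)))
      hlt)
  have hu' := Prod.ext_iff.1 (LinearMap.mem_ker.1 hu)
  exact ⟨u, hu0, hu'.1, fun i hi => congrFun hu'.2 ⟨i, hi⟩⟩

/-- Every linear dependence of the Veronese vectors in `ℝᵏ` has a conformal one on at most `k + 1`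
vectors. -/
lemma exists_conformal {w : Fin n → ℝ} (hw : zonotopeMap t k w = 0) (hw0 : w ≠ 0) :
    ∃ v : Fin n → ℝ, v ≠ 0 ∧ zonotopeMap t k v = 0 ∧ (∀ i, 0 < v i → 0 < w i) ∧
      (∀ i, v i < 0 → w i < 0) ∧ #{i | v i ≠ 0} ≤ k + 1 := by
  obtain ⟨m, hm⟩ : ∃ m, m = #{i | w i ≠ 0} := ⟨_, rfl⟩
  induction m using Nat.strong_induction_on generalizing w with
  | _ m ih =>
  by_cases hcard : #{i | w i ≠ 0} ≤ k + 1
  · exact ⟨w, hw0, hw, fun _ => id, fun _ => id, hcard⟩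
  set S : Finset (Fin n) := {i | w i ≠ 0} with hS
  obtain ⟨j₀, hj₀⟩ := Finset.card_pos.1 (show 0 < #S by omega)
  -- Leaving `j₀` out of the support preserves its coefficient in `w + c • u`, which therefore stays
  -- non-zero.
  obtain ⟨u, hu0, hu, huS⟩ := exists_ne_zero_of_card_lt (t := t) (k := k) (S := S.erase j₀)
    (by rw [Finset.card_erase_of_mem hj₀]; omega)
  -- With signs factored out, conformality becomes non-negativity, so the ratio test applies to `|w
  -- i|` and `σ i * u i`.
  set σ : Fin n → ℝ := fun i => if 0 < w i then 1 else -1 with hσ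
  have hσw : ∀ i, σ i * w i = |w i| := fun i => by
    simp only [hσ]
    split_ifs with h
    · rw [one_mul, abs_of_pos h]
    · rw [neg_one_mul, abs_of_nonpos (not_lt.1 h)]
  have hσ0 : ∀ i, σ i ≠ 0 := fun i => by simp only [hσ]; split_ifs <;> simp
  obtain ⟨u, hu, huS, j, hj⟩ : ∃ u : Fin n → ℝ, zonotopeMap t k u = 0 ∧
      (∀ i ∉ S.erase j₀, u i = 0) ∧ ∃ j, σ j * u j < 0 := by
    obtain ⟨j, hj⟩ := Function.ne_iff.1 hu0
    rcases lt_or_gt_of_ne (mul_ne_zero (hσ0 j) hj) with h | h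
    · exact ⟨u, hu, huS, j, h⟩
    · exact ⟨-u, by rw [map_neg, hu, neg_zero], fun i hi => by simp [huS i hi], j, by simpa using h⟩
  have huw : ∀ i, w i = 0 → u i = 0 := fun i hi => huS i (by simp [hS, hi])
  obtain ⟨c, hc, j₁, hj₁, hj₁c⟩ := exists_add_mul_nonneg (a := fun i => |w i|)
    (h := fun i => σ i * u i) (fun i => abs_nonneg _)
    (fun i hi => by rw [huw i (abs_eq_zero.1 hi), mul_zero]) ⟨j, hj⟩
  have hσv : ∀ i, |w i| + c * (σ i * u i) = σ i * (w + c • u) i := fun i => by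
    rw [← hσw]
    simp only [Pi.add_apply, Pi.smul_apply, smul_eq_mul]
    ring
  simp only [hσv] at hc hj₁c
  have hzero : ∀ i, w i = 0 → (w + c • u) i = 0 := fun i hi => by simp [hi, huw i hi]
  have hpos : ∀ i, 0 < (w + c • u) i → 0 < w i := fun i hi => by
    by_contra h
    have := hc i
    simp only [hσ, if_neg h] at this
    linarith
  have hneg : ∀ i, (w + c • u) i < 0 → w i < 0 := fun i hi => by
    by_contra! h
    rcases h.eq_or_lt with h | h
    · exact hi.ne (hzero i h.symm)
    · have := hc i
      simp only [hσ, if_pos h] at this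
      linarith
  have hlt : #{i | (w + c • u) i ≠ 0} < #S := by
    refine Finset.card_lt_card ⟨fun i hi => ?_, fun h => ?_⟩
    · have hi' : (w + c • u) i ≠ 0 := by simpa using hi
      simpa [hS] using fun h => hi' (hzero i h)
    · have h1 := h (show j₁ ∈ S by simpa [hS] using hj₁)
      have h2 : (w + c • u) j₁ ≠ 0 := by simpa using h1
      exact (mul_ne_zero (hσ0 j₁) h2) hj₁c
  obtain ⟨v, hv0, hv, hvp, hvn, hvc⟩ := ih _ (hm ▸ hlt) (w := w + c • u)
    (by rw [map_add, map_smul, hw, hu, smul_zero, add_zero])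
    (fun h => by
      have h1 := congrFun h j₀
      have h2 : w j₀ ≠ 0 := by simpa [hS] using hj₀
      simp [huS j₀ (Finset.notMem_erase _ _), h2] at h1) rfl
  exact ⟨v, hv0, hv, fun i hi => hpos i (hvp i hi), fun i hi => hneg i (hvn i hi), hvc⟩

/-- A triangulation of `C(n, δ)` is determined by its `⌊δ / 2⌋`-simplices. -/
lemma IsTriangulation.subset_of_simplices {h : δ ≤ n - 1} (ht : Function.Injective t)
    {T T' : Set (Fin (n - 1) → ℝ)} (hT : IsTriangulation h t T) (hT' : IsTriangulation h t T')
    (hTT' : ∀ A : Finset (Fin n), #A = δ / 2 + 1 → (simplex t A ⊆ T ↔ simplex t A ⊆ T')) :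
    T ⊆ T' := by
  intro x hx
  have hxC := hT.1.subset hx
  rw [cyclicPolytope_eq_image] at hxC
  obtain ⟨q, hq, rfl⟩ := hxC
  obtain ⟨q', hq', hqT', hqq'⟩ := hT'.exists_map_eq hq
  suffices q = q' by rwa [this]
  by_contra hne
  obtain ⟨v, hv0, hv, hvpos, hvneg, hvcard⟩ := exists_conformal (t := t) (k := δ + 1)
    (w := q - q') (by rw [map_sub, hqq', sub_self]) (sub_ne_zero.2 hne)
  set P : Finset (Fin n) := {i | 0 < v i} with hP
  set N : Finset (Fin n) := {i | v i < 0} with hN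
  have hPcard : δ / 2 + 1 ≤ #P := half_lt_card_pos ht hv hv0 fun i hi => by
    simpa [hP] using hi
  have hNcard : δ / 2 + 1 ≤ #N := half_lt_card_pos ht (w := -v) (by rw [map_neg, hv, neg_zero])
    (neg_ne_zero.2 hv0) fun i hi => by simpa [hN] using hi
  have hdisj : Disjoint P N := Finset.disjoint_left.2 fun i hi hi' => by
    simp only [hP, hN, Finset.mem_filter, Finset.mem_univ, true_and] at hi hi'
    linarith
  have hPN : #P + #N ≤ δ + 2 := by
    rw [← Finset.card_union_of_disjoint hdisj]
    refine (Finset.card_le_card fun i hi => ?_).trans hvcard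
    simp only [hP, hN, Finset.mem_union, Finset.mem_filter, Finset.mem_univ, true_and] at hi ⊢
    rcases hi with hi | hi
    · exact hi.ne'
    · exact hi.ne
  obtain ⟨a, ha⟩ := Finset.card_pos.1 (show 0 < #P by omega)
  have hva : 0 < v a := by simpa [hP] using ha
  -- The coefficients of `v` sum to zero, so both parts have mass `r`; dividing by it yields points
  -- of `|P|` and `|N|` with the same projection.
  set r : ℝ := ∑ i, max (v i) 0 with hr
  have hr0 : 0 < r := Finset.sum_pos' (fun i _ => le_max_right _ _)
    ⟨a, Finset.mem_univ a, lt_max_of_lt_left hva⟩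
  have hsumv : ∑ i, v i = 0 := by simpa [zonotopeMap_apply] using congrFun hv 0
  have hdecomp : ∀ i, max (v i) 0 - max (-v i) 0 = v i := fun i =>
    max_zero_sub_max_neg_zero_eq_self (v i)
  have hr' : ∑ i, max (-v i) 0 = r := by
    have : ∑ i, (max (v i) 0 - max (-v i) 0) = 0 := by simp only [hdecomp, hsumv]
    rw [Finset.sum_sub_distrib] at this
    linarith
  set p : Fin n → ℝ := r⁻¹ • fun i => max (v i) 0 with hp
  set m : Fin n → ℝ := r⁻¹ • fun i => max (-v i) 0 with hm
  have hpP : p ∈ stdFace P := by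
    refine ⟨⟨fun i => mul_nonneg (inv_nonneg.2 hr0.le) (le_max_right _ _), ?_⟩, fun i hi => ?_⟩
    · simp only [hp, Pi.smul_apply, smul_eq_mul, ← Finset.mul_sum]
      exact inv_mul_cancel₀ hr0.ne'
    · have : v i ≤ 0 := by simpa [hP] using hi
      simp [hp, this]
  have hmN : m ∈ stdFace N := by
    refine ⟨⟨fun i => mul_nonneg (inv_nonneg.2 hr0.le) (le_max_right _ _), ?_⟩, fun i hi => ?_⟩
    · simp only [hm, Pi.smul_apply, smul_eq_mul, ← Finset.mul_sum, hr']
      exact inv_mul_cancel₀ hr0.ne'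
    · have : 0 ≤ v i := by simpa [hN] using hi
      simp [hm, this]
  have hpm : zonotopeMap t (δ + 1) p = zonotopeMap t (δ + 1) m := by
    have hsub : p - m = r⁻¹ • v := by
      ext i
      simp only [hp, hm, Pi.sub_apply, Pi.smul_apply, ← smul_sub, hdecomp]
    rw [← sub_eq_zero, ← map_sub, hsub, map_smul, hv, smul_zero]
  have hpne : p ≠ m := fun heq => by
    have h1 := congrFun heq a
    have h2 : 0 < r⁻¹ * v a := mul_pos (inv_pos.2 hr0) hva
    simp only [hp, hm, Pi.smul_apply, smul_eq_mul, max_eq_left hva.le,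
      max_eq_right (neg_nonpos.2 hva.le), mul_zero] at h1
    linarith
  -- By conformality `v i > 0` forces `q i > q' i ≥ 0`, so `P` lies in the support of `q`;
  -- symmetrically `N` lies in that of `q'`.
  have hPT : simplex t P ⊆ T := by
    rw [simplex_eq_image]
    rintro _ ⟨y, hy, rfl⟩
    refine hT.1.momentMap_mem hx hq hy.1 fun i hi => hy.2 i fun hiP => ?_
    have h1 := hvpos i (by simpa [hP] using hiP)
    have h2 := hq'.1 i
    simp only [Pi.sub_apply] at h1
    linarith
  have hNT' : simplex t N ⊆ T' := by
    rw [simplex_eq_image]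
    rintro _ ⟨y, hy, rfl⟩
    refine hT'.1.momentMap_mem hqT' hq' hy.1 fun i hi => hy.2 i fun hiN => ?_
    have h1 := hvneg i (by simpa [hN] using hiN)
    have h2 := hq.1 i
    simp only [Pi.sub_apply] at h1
    linarith
  have hconfl : ∀ T : Set (Fin (n - 1) → ℝ), IsTriangulation h t T → simplex t P ⊆ T →
      ¬ simplex t N ⊆ T := fun T hT hPT hNT => by
    rw [simplex_eq_image] at hPT hNT
    exact hpne (hT.eq_of_map_eq ht hpP.1 hmN.1 (hPT ⟨p, hpP, rfl⟩) (hNT ⟨m, hmN, rfl⟩) hpm)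
  -- Both parts have at least `⌊δ / 2⌋ + 1` elements and together at most `δ + 2`, so they cannot
  -- both be larger, whatever the parity of `δ`.
  rcases (show #P = δ / 2 + 1 ∨ #N = δ / 2 + 1 by omega) with hc | hc
  · exact hconfl T' hT' ((hTT' P hc).1 hPT) hNT'
  · exact hconfl T hT hPT ((hTT' N hc).2 hNT')

/-- Triangulations of `C(n, δ)` with the same internal `⌊δ / 2⌋`-simplices are equal. -/
lemma IsTriangulation.eq_of_internalSimplices_eq (ht : Function.Injective t) (hδ : δ + 1 ≤ n)
    {T T' : Set (Fin (n - 1) → ℝ)} (hT : IsTriangulation (Nat.le_sub_one_of_lt hδ) t T)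
    (hT' : IsTriangulation (Nat.le_sub_one_of_lt hδ) t T')
    (hTT' : internalSimplices (Nat.le_sub_one_of_lt hδ) t T =
      internalSimplices (Nat.le_sub_one_of_lt hδ) t T') : T = T' := by
  have hiff : ∀ A : Finset (Fin n), #A = δ / 2 + 1 →
      (simplex t A ⊆ T ↔ simplex t A ⊆ T') := fun A hA => by
    have hAne : A.Nonempty := Finset.card_pos.1 (by omega)
    by_cases hint : IsInternalSimplex (Nat.le_sub_one_of_lt hδ) t A
    · have := Set.ext_iff.1 hTT' A
      simpa only [internalSimplices, Set.mem_ofPred_eq, hA, hint, and_true, true_and,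
        isFaceIn_simplex_iff (show 0 < n by omega) ht hAne] using this
    · have hsupp := (not_isInternalSimplex_iff ht hδ hAne).1 hint
      exact iff_of_true (hT.simplex_subset_of_hasSupportingPolynomial ht hsupp)
        (hT'.simplex_subset_of_hasSupportingPolynomial ht hsupp)
  exact Set.Subset.antisymm (hT.subset_of_simplices ht hT' hiff)
    (hT'.subset_of_simplices ht hT fun A hA => (hiff A hA).symm)

/-- The internal `⌊δ / 2⌋`-simplices of `g Q` are given by the internal spectrum of `Q`. -/
lemma IsCubillage.internalSimplices_g (hn : 2 ≤ n) (ht : Function.Injective t) (hδ : δ + 1 ≤ n)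
    {Q : Set (Fin n → ℝ)} (hQ : IsCubillage hδ t Q) :
    internalSimplices (Nat.le_sub_one_of_lt hδ) t (g Q) =
      internalSpectrum hδ t Q ∩ {A | A.card = δ / 2 + 1} := by
  ext A
  simp only [internalSimplices, internalSpectrum, Set.mem_inter_iff, Set.mem_ofPred_eq]
  rw [and_comm]
  refine and_congr_left fun hA => ?_
  have hAne : A.Nonempty := Finset.card_pos.1 (by omega)
  have hn0 : 0 < n := by omega
  rw [isFaceIn_simplex_iff hn0 ht hAne, mem_spectrum_iff hn0 ht, ← zonotopeMap_indicatorVec,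
    proj_zonotopeMap, mem_interior_zonotope_iff hn ht hδ hA, ← not_isInternalSimplex_iff ht hδ hAne,
    not_not, zonotopeMap_indicatorVec]
  exact and_congr_left fun _ =>
    ⟨xi_mem_of_simplex_subset_g hQ.1 hAne, hQ.simplex_subset_g ht hA⟩

end CyclicCubillage

theorem proposition4p6 (n δ : ℕ) (hn : 2 ≤ n) (hδ : δ + 1 ≤ n) (t : Fin n → ℝ)
    (ht : StrictMono t) (Q : Set (Fin n → ℝ)) (hQ : CyclicCubillage.IsCubillage hδ t Q) :
    CyclicCubillage.IsTriangulation (Nat.le_sub_one_of_lt hδ) t (CyclicCubillage.g Q) ∧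
    CyclicCubillage.internalSimplices (Nat.le_sub_one_of_lt hδ) t (CyclicCubillage.g Q) =
      CyclicCubillage.internalSpectrum hδ t Q ∩ {A | A.card = δ / 2 + 1} ∧
    ∀ T : Set (Fin (n - 1) → ℝ),
      CyclicCubillage.IsTriangulation (Nat.le_sub_one_of_lt hδ) t T →
      CyclicCubillage.internalSimplices (Nat.le_sub_one_of_lt hδ) t T =
        CyclicCubillage.internalSpectrum hδ t Q ∩ {A | A.card = δ / 2 + 1} →
      T = CyclicCubillage.g Q := by
  have hg := hQ.isTriangulation_g (by omega) hδ ht.injective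
  have hs := hQ.internalSimplices_g hn ht.injective hδ
  exact ⟨hg, hs, fun T hT hTs =>
    hT.eq_of_internalSimplices_eq ht.injective hδ hg (hTs.trans hs.symm)⟩
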